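/- Model. Let $M\ge 0$, $\lambda_{D_i}>0$, $p_{t_i},p_{f_i}\in[0,1]$ ($1\le i\le M$), $\lambda_B,P_D,P_B,\delta>0$, $\rho^{(S)}\in[0,1]$ and $\alpha>2$. In the plane, let $\Phi_B$ (base stations) and $\Phi_{D_1},\dots,\Phi_{D_M}$ (potential D2D transmitters) be independent homogeneous Poisson point processes with densities $\lambda_B,\lambda_{D_1},\dots,\lambda_{D_M}$. On a given resource block, each point of $\Phi_{D_i}$ is active in the time slot with probability $p_{t_i}$ and accesses the subband with probability $p_{f_i}$, and each base station transmits (sends a normal rather than a blank resource block) with probability $\rho^{(S)}$. Let $\tilde\Phi_D$ be the set of D2D transmitters that are active and access the subband, and $\tilde\Phi_B$ the set of transmitting base stations. Every transmitter $x$ has a fading gain $h_x$ to the origin, exponentially distributed with mean $1$. All these choices and gains are independent of each other and of the point processes. A typical active D2D link has its receiver at the origin and its transmitter at $X_0\sim N(0,\delta^2 I_2)$, with gain $h_0\sim\mathrm{Exp}(1)$; $X_0$ and $h_0$ are independent of each other and of everything above ($X_0\notin\tilde\Phi_D$: the interferers are the other links). A typical cellular user is at the origin and is served by the base station $B_0$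 of $\Phi_B$ nearest to it. With noise power $\sigma^2\ge 0$ let $$\mathrm{SINR}_D=\frac{P_Dh_0|X_0|^{-\alpha}}{\sum_{x\in\tilde\Phi_D}P_Dh_x|x|^{-\alpha}+\sum_{x\in\tilde\Phi_B}P_Bh_x|x|^{-\alpha}+\sigma^2},$$ $$\mathrm{SINR}_C=\frac{P_Bh_{B_0}|B_0|^{-\alpha}}{\sum_{x\in\tilde\Phi_D}P_Dh_x|x|^{-\alpha}+\sum_{x\in\tilde\Phi_B\setminus\{B_0\}}P_Bh_x|x|^{-\alpha}+\sigma^2},$$ where a positive number divided by $0$ is $+\infty$, and let $\mathbb P_D^{(S)}(\beta)=\mathbb P(\mathrm{SINR}_D>\beta)$ and $\mathbb P_C^{(S)}(\beta)=\mathbb P(\mathrm{SINR}_C>\beta)$. Put $$\tilde\lambda_D=\sum_{i=1}^M p_{t_i}p_{f_i}\lambda_{D_i},\qquad \kappa=\frac{2\pi/\alpha}{\sin(2\pi/\alpha)},$$ $$H_0(\beta,\alpha)=\int_0^\infty\frac{x}{1+\beta^{-1}\frac{P_D}{P_B}x^\alpha}\,dx,\qquad H_1(\beta,\alpha)=\int_1^\infty\frac{x}{1+\beta^{-1}x^\alpha}\,dx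 .$$ Statement. For every $\beta>0$ the integrals $H_0(\beta,\alpha)$ and $H_1(\beta,\alpha)$ converge. As $\sigma^2\to 0^+$, the coverage probabilities of D2D links and of cellular users converge, respectively, to $$\mathbb P_D^{(S)}(\beta)=\frac{1}{2\delta^2\tilde\lambda_D\kappa\pi\beta^{2/\alpha}+4\delta^2\pi\rho^{(S)}\lambda_BH_0(\beta,\alpha)+1}$$ and $$\mathbb P_C^{(S)}(\beta)=\frac{1}{\frac{\tilde\lambda_D}{\lambda_B}\kappa\left(\beta\frac{P_D}{P_B}\right)^{2/\alpha}+2\rho^{(S)}H_1(\beta,\alpha)+1},$$ and these are also their values at $\sigma^2=0$. -/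

import Mathlib

open MeasureTheory ProbabilityTheory Filter Topology Set
open scoped ENNReal NNReal

noncomputable section

namespace D2D

/-- The plane with its Euclidean norm. -/
abbrev Plane : Type := EuclideanSpace ℝ (Fin 2)

/-- The number of points of the sequence `X` that lie in `A`. -/
def count {Ω : Type*} (X : ℕ → Ω → Plane) (A : Set Plane) (ω : Ω) : ℕ∞ :=
  {n : ℕ | X n ω ∈ A}.encard

/-- The points `X 0, X 1, …` enumerate a homogeneous Poisson point process in the plane with
density `lam`: the number of points in a Borel set of finite area is Poisson distributed with mean
`lam * area`, and the numbers of points in disjoint such sets are independent. -/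
structure IsPoissonProcess {Ω : Type*} [MeasurableSpace Ω] (P : Measure Ω)
    (X : ℕ → Ω → Plane) (lam : ℝ) : Prop where
  measurable : ∀ n, Measurable (X n)
  count_law : ∀ A : Set Plane, MeasurableSet A → volume A ≠ ∞ → ∀ k : ℕ,
    P {ω | count X A ω = k} = poissonMeasure (lam * volume.real A).toNNReal {k}
  count_indep : ∀ (m : ℕ) (A : Fin m → Set Plane), (∀ j, MeasurableSet (A j)) →
    (∀ j, volume (A j) ≠ ∞) → Pairwise (fun j l => Disjoint (A j) (A l)) →
    iIndepFun (fun j => count X (A j)) P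

/-- The parameters of a shared network with `M` types of D2D links. -/
structure Params (M : ℕ) where
  /-- densities of the D2D transmitters of each type -/
  lamD : Fin M → ℝ
  /-- time hopping probabilities -/
  pt : Fin M → ℝ
  /-- frequency hopping probabilities -/
  pf : Fin M → ℝ
  /-- density of the base stations -/
  lamB : ℝ
  /-- fraction of normal (non-blank) resource blocks; any value in `[0, 1]` -/
  rho : ℝ
  /-- transmit power of a D2D transmitter -/
  PD : ℝ
  /-- transmit power of a base station -/
  PB : ℝ
  /-- standard deviation of each coordinate of the displacement between the two ends of a link -/
  del : ℝ
  /-- path loss exponent -/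
  α : ℝ
  lamD_pos : ∀ i, 0 < lamD i
  pt_mem : ∀ i, pt i ∈ Icc (0 : ℝ) 1
  pf_mem : ∀ i, pf i ∈ Icc (0 : ℝ) 1
  lamB_pos : 0 < lamB
  rho_mem : rho ∈ Icc (0 : ℝ) 1
  PD_pos : 0 < PD
  PB_pos : 0 < PB
  del_pos : 0 < del
  two_lt_α : 2 < α

namespace Params

variable {M : ℕ} (p : Params M)

/-- The density of the interfering D2D transmitters on a resource block. -/
def lamTilde : ℝ := ∑ i, p.pt i * p.pf i * p.lamD i

/-- `κ = (2π/α) / sin (2π/α)`. -/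
def kappa : ℝ := (2 * Real.pi / p.α) / Real.sin (2 * Real.pi / p.α)

/-- The integrand of `H₀`. -/
def H0fun (β x : ℝ) : ℝ := x / (1 + β⁻¹ * (p.PD / p.PB) * x ^ p.α)

/-- The integrand of `H₁`. -/
def H1fun (β x : ℝ) : ℝ := x / (1 + β⁻¹ * x ^ p.α)

/-- `H₀(β, α) = ∫₀^∞ x / (1 + β⁻¹ (P_D/P_B) x^α) dx`. -/
def H0 (β : ℝ) : ℝ := ∫ x in Ioi (0 : ℝ), p.H0fun β x

/-- `H₁(β, α) = ∫₁^∞ x / (1 + β⁻¹ x^α) dx`. -/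
def H1 (β : ℝ) : ℝ := ∫ x in Ioi (1 : ℝ), p.H1fun β x

end Params

/-- The random elements of the network, as seen at one resource block by a typical receiver located
at the origin. The receiver is either the receiver of a typical active D2D link, whose transmitter
is at `X0`, or a typical cellular user. The families `X`, `Y` locate the other D2D transmitters and
the base stations. -/
structure Elements (M : ℕ) (Ω : Type*) where
  /-- location of the transmitter of the typical D2D link -/
  X0 : Ω → Plane
  /-- fading of the typical D2D link -/
  h0 : Ω → ℝ
  /-- locations of the potential D2D transmitters of each type, other than the typical one -/
  X : Fin M → ℕ → Ω → Plane
  /-- fading from these transmitters to the origin -/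
  h : Fin M → ℕ → Ω → ℝ
  /-- whether the D2D link is active (in D2D mode) in the time slot -/
  timeOn : Fin M → ℕ → Ω → Bool
  /-- whether the D2D link accesses the subband -/
  freqOn : Fin M → ℕ → Ω → Bool
  /-- locations of the base stations -/
  Y : ℕ → Ω → Plane
  /-- fading from the base stations to the origin -/
  g : ℕ → Ω → ℝ
  /-- whether the base station sends a normal resource block (as opposed to a blank one) -/
  busy : ℕ → Ω → Bool

/-- Names of the random elements that are mutually independent: one for each point process (as a
whole) and one for each individual mark. -/
inductive Label (M : ℕ) where
  | linkLoc
  | linkFading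
  | d2dLoc (i : Fin M)
  | d2dFading (i : Fin M) (n : ℕ)
  | d2dTime (i : Fin M) (n : ℕ)
  | d2dFreq (i : Fin M) (n : ℕ)
  | bsLoc
  | bsFading (n : ℕ)
  | bsBusy (n : ℕ)

namespace Elements

variable {M : ℕ} {Ω : Type*} (E : Elements M Ω)

/-- The σ-algebra generated by the random element with the given name. -/
def sigma : Label M → MeasurableSpace Ω
  | .linkLoc => MeasurableSpace.comap E.X0 inferInstance
  | .linkFading => MeasurableSpace.comap E.h0 inferInstance
  | .d2dLoc i => MeasurableSpace.comap (fun ω n => E.X i n ω) inferInstance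
  | .d2dFading i n => MeasurableSpace.comap (E.h i n) inferInstance
  | .d2dTime i n => MeasurableSpace.comap (E.timeOn i n) inferInstance
  | .d2dFreq i n => MeasurableSpace.comap (E.freqOn i n) inferInstance
  | .bsLoc => MeasurableSpace.comap (fun ω n => E.Y n ω) inferInstance
  | .bsFading n => MeasurableSpace.comap (E.g n) inferInstance
  | .bsBusy n => MeasurableSpace.comap (E.busy n) inferInstance

end Elements

/-- The probabilistic model of the shared network with parameters `p`. Rayleigh fading means that
the power gains are exponentially distributed with mean one. -/
structure IsSharedNetwork {M : ℕ} (p : Params M) {Ω : Type*} [MeasurableSpace Ω]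
    (P : Measure Ω) (E : Elements M Ω) : Prop where
  X0_measurable : Measurable E.X0
  X0_law : P.map E.X0 = (stdGaussian Plane).map (fun x => p.del • x)
  h0_measurable : Measurable E.h0
  h0_law : P.map E.h0 = expMeasure 1
  X_poisson : ∀ i, IsPoissonProcess P (E.X i) (p.lamD i)
  h_measurable : ∀ i n, Measurable (E.h i n)
  h_law : ∀ i n, P.map (E.h i n) = expMeasure 1
  timeOn_measurable : ∀ i n, Measurable (E.timeOn i n)
  timeOn_law : ∀ i n, P {ω | E.timeOn i n ω = true} = ENNReal.ofReal (p.pt i)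
  freqOn_measurable : ∀ i n, Measurable (E.freqOn i n)
  freqOn_law : ∀ i n, P {ω | E.freqOn i n ω = true} = ENNReal.ofReal (p.pf i)
  Y_poisson : IsPoissonProcess P E.Y p.lamB
  g_measurable : ∀ n, Measurable (E.g n)
  g_law : ∀ n, P.map (E.g n) = expMeasure 1
  busy_measurable : ∀ n, Measurable (E.busy n)
  busy_law : ∀ n, P {ω | E.busy n ω = true} = ENNReal.ofReal p.rho
  independent : iIndep E.sigma P

/-- Power received at the origin from a transmitter at `x` with power `Q` and fading `f`:
`Q f |x|^{-α}`. -/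
def rxPower (α Q f : ℝ) (x : Plane) : ℝ≥0∞ :=
  ENNReal.ofReal Q * ENNReal.ofReal f * ‖x‖ₑ ^ (-α)

namespace Elements

variable {M : ℕ} {Ω : Type*} (E : Elements M Ω) (p : Params M)

/-- Interference from the D2D transmitters that are active in the time slot and access the
subband, the typical one excluded. -/
def interfD (ω : Ω) : ℝ≥0∞ :=
  ∑ i, ∑' n, if E.timeOn i n ω = true ∧ E.freqOn i n ω = true then
    rxPower p.α p.PD (E.h i n ω) (E.X i n ω) else 0

/-- Interference at the typical D2D receiver from the base stations: all those that transmit. -/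
def interfB (ω : Ω) : ℝ≥0∞ :=
  ∑' n, if E.busy n ω = true then rxPower p.α p.PB (E.g n ω) (E.Y n ω) else 0

/-- SINR of the typical D2D link with noise power `σ2`. -/
def sinrD (σ2 : ℝ) (ω : Ω) : ℝ≥0∞ :=
  rxPower p.α p.PD (E.h0 ω) (E.X0 ω) / (E.interfD p ω + E.interfB p ω + ENNReal.ofReal σ2)

/-- The base station serving the typical cellular user: the one nearest to the origin. -/
def serving (ω : Ω) : ℕ := sInf {n | ∀ m, ‖E.Y n ω‖ ≤ ‖E.Y m ω‖}

/-- Interference at the typical cellular user from the base stations: all those that transmit,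
except the serving one. -/
def interfBC (ω : Ω) : ℝ≥0∞ :=
  ∑' n, if E.busy n ω = true ∧ n ≠ E.serving ω then
    rxPower p.α p.PB (E.g n ω) (E.Y n ω) else 0

/-- SINR of the typical cellular user with noise power `σ2`. -/
def sinrC (σ2 : ℝ) (ω : Ω) : ℝ≥0∞ :=
  rxPower p.α p.PB (E.g (E.serving ω) ω) (E.Y (E.serving ω) ω) /
    (E.interfD p ω + E.interfBC p ω + ENNReal.ofReal σ2)

variable [MeasurableSpace Ω] (P : Measure Ω)

/-- Coverage probability of the D2D links: `P(SINR_D > β)`. -/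
def coverD (σ2 β : ℝ) : ℝ := P.real {ω | ENNReal.ofReal β < E.sinrD p σ2 ω}

/-- Coverage probability of the cellular users: `P(SINR_C > β)`. -/
def coverC (σ2 β : ℝ) : ℝ := P.real {ω | ENNReal.ofReal β < E.sinrC p σ2 ω}

end Elements

end D2D

end

/-! Rayleigh fading turns coverage into a Laplace transform. Given everything except the gain of the
useful signal, SINR > β says that this Exp(1) gain exceeds `T`, the noise plus interference
multiplied by `β r^α / Q`, where `r` is the link length and `Q` the useful power (`lt_sinr_iff`).
Its probability is therefore `E[e^{-T}]` (`measure_lt_ofReal_of_exp`), and `e^{-T}` splits into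
independent factors.

For one field of interferers, average over the marks with the locations fixed: each point `y`
contributes a factor `markLaplace`, that is `1 - q (1 - 1/(1+w))` with `w` proportional to
`(r/|y|)^α`. The product over a Poisson process of density λ averages to `exp(-λ ∫ (1 - factor))`
(`IsPoissonProcess.laplace`, `IsMarked.lintegral_interf`). Since the factor depends only on `|y|/r`,
polar coordinates and scaling make the exponent a constant times `r²` (`lossIntegral_markLaplace`).
Over the whole plane the radial integral is a Beta integral, which produces κ by the reflection
formula (`integral_lossKernel`).

At zero noise what remains is `E[e^{-A r²}]`. For a D2D link `r = |X0|` is Gaussian, giving `1/(1 +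
2δ²A)` (`lintegral_normSq_X0`). For a cellular user `r` is the distance to the nearest base station
and `π λ_B r²` is Exp(1), giving `1/(1 + A/(π λ_B))` (`lintegral_nearDist_sq`). In that case the
other stations must form, given `r`, a Poisson process outside the disc of radius `r`;
`IsPoissonProcess.lintegral_nearest` proves this by discretising `r` on dyadic cells.

The limit of small noise is dominated convergence, all integrands being at most 1
(`tendsto_coverage`). Values are kept in `[0, ∞]` throughout, so the interference never has to be
shown finite. -/

namespace D2D

/-! ### Exponential and logarithm on `[0, ∞]`. -/

/-- `e^{-t}` for `t ∈ [0, ∞]`, with `e^{-∞} = 0`. -/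
noncomputable def expNeg (t : ℝ≥0∞) : ℝ≥0∞ := EReal.exp (-(t : EReal))

/-- `-log u` for `u ∈ [0, 1]`, with `-log 0 = ∞`. -/
noncomputable def negLog (u : ℝ≥0∞) : ℝ≥0∞ := (-ENNReal.log u).toENNReal

@[simp] lemma expNeg_zero : expNeg 0 = 1 := by simp [expNeg]

@[simp] lemma expNeg_top : expNeg ∞ = 0 := by simp [expNeg]

lemma expNeg_add (s t : ℝ≥0∞) : expNeg (s + t) = expNeg s * expNeg t := by
  rw [expNeg, expNeg, expNeg, ← EReal.exp_add, EReal.coe_ennreal_add, EReal.neg_add, sub_eq_add_neg]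
  · exact Or.inl (by simp)
  · exact Or.inr (by simp)

lemma expNeg_sum {ι : Type*} (s : Finset ι) (f : ι → ℝ≥0∞) :
    expNeg (∑ i ∈ s, f i) = ∏ i ∈ s, expNeg (f i) := by
  classical
  induction s using Finset.induction_on with
  | empty => simp
  | insert a s ha ih => rw [Finset.sum_insert ha, Finset.prod_insert ha, expNeg_add, ih]

lemma expNeg_antitone : Antitone expNeg := fun s t h => by
  simpa [expNeg] using h

lemma expNeg_le_one (t : ℝ≥0∞) : expNeg t ≤ 1 := by
  simpa using expNeg_antitone (zero_le (a := t))

lemma expNeg_ne_top (t : ℝ≥0∞) : expNeg t ≠ ∞ :=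
  ((expNeg_le_one t).trans_lt ENNReal.one_lt_top).ne

lemma continuous_expNeg : Continuous expNeg :=
  ENNReal.continuous_exp.comp (continuous_neg.comp continuous_coe_ennreal_ereal)

lemma measurable_expNeg : Measurable expNeg := continuous_expNeg.measurable

lemma expNeg_ofReal {t : ℝ} (ht : 0 ≤ t) :
    expNeg (ENNReal.ofReal t) = ENNReal.ofReal (Real.exp (-t)) := by
  rw [expNeg, EReal.coe_ennreal_ofReal, max_eq_left ht, ← EReal.coe_neg, EReal.exp_coe]

lemma expNeg_negLog {u : ℝ≥0∞} (hu : u ≤ 1) : expNeg (negLog u) = u := by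
  rw [expNeg, negLog, EReal.coe_toENNReal (by simpa using hu), neg_neg, ENNReal.exp_log]

lemma negLog_antitone : Antitone negLog := fun _ _ h =>
  EReal.toENNReal_le_toENNReal (EReal.neg_le_neg_iff.2 (ENNReal.log_le_log h))

lemma continuous_negLog : Continuous negLog :=
  EReal.continuous_toENNReal.comp (continuous_neg.comp ENNReal.continuous_log)

lemma measurable_negLog : Measurable negLog := continuous_negLog.measurable

/-! ### Laplace transforms of independent sums, and independence by groups. -/

section Independence

variable {Ω : Type*} [MeasurableSpace Ω] {P : Measure Ω}

lemma lintegral_expNeg_le_one [IsProbabilityMeasure P] (f : Ω → ℝ≥0∞) : ∫⁻ ω, expNeg (f ω) ∂P ≤ 1 := by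
  calc ∫⁻ ω, expNeg (f ω) ∂P ≤ ∫⁻ _, 1 ∂P := lintegral_mono fun ω => expNeg_le_one _
    _ = 1 := by simp

/-- Dominated convergence for `e^{-f}`. -/
lemma tendsto_lintegral_expNeg [IsProbabilityMeasure P] {ι : Type*} {l : Filter ι} [l.IsCountablyGenerated]
    {F : ι → Ω → ℝ≥0∞} {f : Ω → ℝ≥0∞} (hF : ∀ i, Measurable (F i))
    (h : ∀ᵐ ω ∂P, Tendsto (fun i => F i ω) l (𝓝 (f ω))) :
    Tendsto (fun i => ∫⁻ ω, expNeg (F i ω) ∂P) l (𝓝 (∫⁻ ω, expNeg (f ω) ∂P)) := by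
  refine tendsto_lintegral_filter_of_dominated_convergence (fun _ => 1)
    (Eventually.of_forall fun i => measurable_expNeg.comp (hF i))
    (Eventually.of_forall fun i => Eventually.of_forall fun ω => expNeg_le_one _) (by simp) ?_
  filter_upwards [h] with ω hω using (continuous_expNeg.tendsto _).comp hω

lemma lintegral_expNeg_sum {ι : Type*} {Z : ι → Ω → ℝ≥0∞} (hZ : ∀ n, Measurable (Z n))
    (hind : iIndepFun Z P) (s : Finset ι) :
    ∫⁻ ω, expNeg (∑ n ∈ s, Z n ω) ∂P = ∏ n ∈ s, ∫⁻ ω, expNeg (Z n ω) ∂P := by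
  simp_rw [expNeg_sum]
  exact lintegral_prod_eq_prod_lintegral_of_indepFun s (fun n ω => expNeg (Z n ω))
    (hind.comp (fun _ => expNeg) fun _ => measurable_expNeg)
    (fun n => measurable_expNeg.comp (hZ n))

/-- The infinite product of Laplace transforms is encoded as `expNeg` of a sum of `negLog`, which
always makes sense in `[0, ∞]` and has the form to which the Poisson Laplace functional applies.
Finite products pass to the limit by dominated convergence. -/
lemma lintegral_expNeg_tsum [IsProbabilityMeasure P] {Z : ℕ → Ω → ℝ≥0∞} (hZ : ∀ n, Measurable (Z n))
    (hind : iIndepFun Z P) :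
    ∫⁻ ω, expNeg (∑' n, Z n ω) ∂P = expNeg (∑' n, negLog (∫⁻ ω, expNeg (Z n ω) ∂P)) := by
  have h1 : Tendsto (fun N => ∫⁻ ω, expNeg (∑ n ∈ Finset.range N, Z n ω) ∂P) atTop
      (𝓝 (∫⁻ ω, expNeg (∑' n, Z n ω) ∂P)) :=
    tendsto_lintegral_expNeg (fun N => Finset.measurable_fun_sum _ fun n _ => hZ n)
      (Eventually.of_forall fun ω => ENNReal.tendsto_nat_tsum _)
  have h2 : Tendsto (fun N => expNeg (∑ n ∈ Finset.range N,
      negLog (∫⁻ ω, expNeg (Z n ω) ∂P))) atTop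
      (𝓝 (expNeg (∑' n, negLog (∫⁻ ω, expNeg (Z n ω) ∂P)))) :=
    (continuous_expNeg.tendsto _).comp (ENNReal.tendsto_nat_tsum _)
  refine tendsto_nhds_unique h1 (h2.congr fun N => ?_)
  rw [lintegral_expNeg_sum hZ hind, expNeg_sum]
  exact Finset.prod_congr rfl fun n _ => expNeg_negLog (lintegral_expNeg_le_one _)

lemma lintegral_expNeg_add {Z W : Ω → ℝ≥0∞} (hZ : Measurable Z) (hW : Measurable W)
    (h : IndepFun Z W P) :
    ∫⁻ ω, expNeg (Z ω + W ω) ∂P = (∫⁻ ω, expNeg (Z ω) ∂P) * ∫⁻ ω, expNeg (W ω) ∂P := by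
  simp_rw [expNeg_add]
  exact lintegral_mul_eq_lintegral_mul_lintegral_of_indepFun (measurable_expNeg.comp hZ)
    (measurable_expNeg.comp hW) (h.comp measurable_expNeg measurable_expNeg)

/-- Integrating out one of two independent random elements. -/
lemma lintegral_of_indepFun [IsProbabilityMeasure P] {α β : Type*} [MeasurableSpace α] [MeasurableSpace β] {X : Ω → α}
    {Y : Ω → β} (hX : Measurable X) (hY : Measurable Y) (h : IndepFun X Y P)
    {F : α → β → ℝ≥0∞} (hF : Measurable (Function.uncurry F)) :
    ∫⁻ ω, F (X ω) (Y ω) ∂P = ∫⁻ ω, ∫⁻ ω', F (X ω) (Y ω') ∂P ∂P := by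
  have : IsProbabilityMeasure (P.map Y) := Measure.isProbabilityMeasure_map hY.aemeasurable
  have : IsProbabilityMeasure (P.map X) := Measure.isProbabilityMeasure_map hX.aemeasurable
  have h1 : ∫⁻ ω, F (X ω) (Y ω) ∂P
      = ∫⁻ z, Function.uncurry F z ∂(P.map fun ω => (X ω, Y ω)) := by
    rw [lintegral_map hF (hX.prodMk hY)]; rfl
  rw [h1, (indepFun_iff_map_prod_eq_prod_map_map hX.aemeasurable hY.aemeasurable).1 h,
    lintegral_prod _ hF.aemeasurable, lintegral_map (hF.lintegral_prod_right') hX]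
  refine lintegral_congr fun ω => ?_
  rw [lintegral_map (f := fun y => Function.uncurry F (X ω, y))
    (hF.comp measurable_prodMk_left) hY]
  rfl

lemma indepFun_of_disjoint {ι α β : Type*} [MeasurableSpace α] [MeasurableSpace β]
    {m : ι → MeasurableSpace Ω} (h_le : ∀ l, m l ≤ ‹MeasurableSpace Ω›) (h : iIndep m P)
    {S T : Set ι} (hST : Disjoint S T) {f : Ω → α} {g : Ω → β}
    (hf : Measurable[⨆ l ∈ S, m l] f) (hg : Measurable[⨆ l ∈ T, m l] g) : IndepFun f g P :=
  indep_of_indep_of_le_left (indep_of_indep_of_le_right (indep_iSup_of_disjoint h_le h hST)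
    (measurable_iff_comap_le.1 hg)) (measurable_iff_comap_le.1 hf)

/-- Induction on the finite index set: the group of the new index is disjoint from the union of the
earlier groups, so the new event splits off as a factor. -/
lemma iIndepFun_of_pairwise_disjoint [IsProbabilityMeasure P] {ι κ : Type*} {β : κ → Type*} [∀ k, MeasurableSpace (β k)]
    {m : ι → MeasurableSpace Ω} (h_le : ∀ l, m l ≤ ‹MeasurableSpace Ω›) (h : iIndep m P)
    {S : κ → Set ι} (hS : Pairwise (Function.onFun Disjoint S)) {f : ∀ k, Ω → β k}
    (hf : ∀ k, Measurable[⨆ l ∈ S k, m l] (f k)) : iIndepFun f P := by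
  classical
  rw [iIndepFun_iff_measure_inter_preimage_eq_mul]
  intro s A hA
  have key : ∀ k ∈ s, MeasurableSet[⨆ l ∈ S k, m l] (f k ⁻¹' A k) := fun k hk => hf k (hA k hk)
  clear hA
  induction s using Finset.induction_on with
  | empty => simp
  | insert a s ha ih =>
    rw [Finset.set_biInter_insert, Finset.prod_insert ha,
      ← ih fun k hk => key k (Finset.mem_insert_of_mem hk)]
    have hd : Disjoint (S a) (⋃ k ∈ s, S k) := by
      simp only [disjoint_iUnion_right]
      intro k hk
      exact hS fun hak => ha (hak ▸ hk)
    refine (Indep_iff _ _ _).1 (indep_iSup_of_disjoint h_le h hd) _ _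
      (key a (Finset.mem_insert_self _ _)) (Finset.measurableSet_biInter _ fun k hk => ?_)
    refine (biSup_mono fun l hl => ?_ :
      (⨆ l ∈ S k, m l) ≤ ⨆ l ∈ ⋃ k ∈ s, S k, m l) _ (key k (Finset.mem_insert_of_mem hk))
    exact mem_biUnion hk hl

end Independence

/-! ### The Laplace functional of a Poisson process. -/

/-- Monotone convergence for series in `[0, ∞]`. -/
lemma tendsto_tsum_of_monotone {F : ℕ → ℕ → ℝ≥0∞} {f : ℕ → ℝ≥0∞}
    (hmono : ∀ n, Monotone fun k => F k n) (h : ∀ n, Tendsto (fun k => F k n) atTop (𝓝 (f n))) :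
    Tendsto (fun k => ∑' n, F k n) atTop (𝓝 (∑' n, f n)) := by
  simp_rw [← lintegral_count]
  exact lintegral_tendsto_of_tendsto_of_monotone (fun k => (measurable_of_countable _).aemeasurable)
    (Eventually.of_forall hmono) (Eventually.of_forall h)

/-- `∫ (1 - e^{-f}) dx`. -/
noncomputable def lossIntegral (f : Plane → ℝ≥0∞) : ℝ≥0∞ := ∫⁻ x, (1 - expNeg (f x))

section Count

variable {Ω : Type*}

lemma coe_count (X : ℕ → Ω → Plane) (A : Set Plane) (ω : Ω) :
    ((count X A ω : ℕ∞) : ℝ≥0∞) = ∑' n, A.indicator (fun _ => 1) (X n ω) := by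
  rw [count, ← ENNReal.tsum_set_one, tsum_subtype _ fun _ => (1 : ℝ≥0∞)]
  rfl

variable [MeasurableSpace Ω] {P : Measure Ω} {X : ℕ → Ω → Plane} {lam : ℝ}

lemma measurable_count (hX : ∀ n, Measurable (X n)) {A : Set Plane} (hA : MeasurableSet A) :
    Measurable (count X A) := by
  have h1 : Measurable fun ω => ((count X A ω : ℕ∞) : ℝ≥0∞) := by
    simp_rw [coe_count]
    exact Measurable.tsum fun n => (measurable_const.indicator hA).comp (hX n)
  refine measurable_to_countable' fun k => ?_
  have : count X A ⁻¹' {k} = (fun ω => ((count X A ω : ℕ∞) : ℝ≥0∞)) ⁻¹' {(k : ℝ≥0∞)} := by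
    ext ω; simp
  rw [this]
  exact h1 (measurableSet_singleton _)

/-- `count_law` speaks only of finite counts. A probability on `ℕ∞` is determined by its finite
atoms, the mass at `⊤` being the complement, so an infinite count has probability zero. -/
lemma IsPoissonProcess.map_count [IsProbabilityMeasure P] (hX : IsPoissonProcess P X lam)
    {A : Set Plane} (hA : MeasurableSet A) (hA' : volume A ≠ ∞) :
    P.map (count X A) =
      (poissonMeasure (lam * volume.real A).toNNReal).map (fun k : ℕ => (k : ℕ∞)) := by
  have hc := measurable_count hX.measurable hA
  have : IsProbabilityMeasure (P.map (count X A)) := Measure.isProbabilityMeasure_map hc.aemeasurable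
  have hcast : Measurable (fun k : ℕ => (k : ℕ∞)) := measurable_of_countable _
  have : IsProbabilityMeasure
      ((poissonMeasure (lam * volume.real A).toNNReal).map (fun k : ℕ => (k : ℕ∞))) :=
    Measure.isProbabilityMeasure_map hcast.aemeasurable
  have key : ∀ k : ℕ, P.map (count X A) {(k : ℕ∞)} =
      (poissonMeasure (lam * volume.real A).toNNReal).map (fun k : ℕ => (k : ℕ∞)) {(k : ℕ∞)} := by
    intro k
    rw [Measure.map_apply hc (measurableSet_singleton _),
      Measure.map_apply hcast (measurableSet_singleton _)]
    have : (fun k : ℕ => (k : ℕ∞)) ⁻¹' {(k : ℕ∞)} = {k} := by ext; simp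
    rw [this, ← hX.count_law A hA hA' k]
    rfl
  have htop : ∀ μ : Measure ℕ∞, IsProbabilityMeasure μ → μ {⊤} = 1 - ∑' k : ℕ, μ {(k : ℕ∞)} := by
    intro μ _
    have h1 : ({⊤} : Set ℕ∞) = (⋃ k : ℕ, {(k : ℕ∞)})ᶜ := by
      ext a
      induction a using ENat.recTopCoe <;> simp
    rw [h1, prob_compl_eq_one_sub (MeasurableSet.of_discrete), measure_iUnion _ fun _ => MeasurableSet.of_discrete]
    intro i j hij
    simpa using hij
  refine Measure.ext_of_singleton fun a => ?_
  induction a using ENat.recTopCoe with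
  | top => rw [htop _ inferInstance, htop _ inferInstance]; simp_rw [key]
  | coe k => exact key k

lemma expNeg_mul_natCast (c : ℝ≥0∞) (k : ℕ) : expNeg (c * k) = expNeg c ^ k := by
  induction k with
  | zero => simp
  | succ k ih => rw [Nat.cast_succ, mul_add, mul_one, expNeg_add, ih, pow_succ]

lemma lintegral_pow_poissonMeasure (r : ℝ≥0) {u : ℝ≥0∞} (hu : u ≤ 1) :
    ∫⁻ k : ℕ, u ^ k ∂(poissonMeasure r) = expNeg (r * (1 - u)) := by
  lift u to ℝ≥0 using (hu.trans_lt ENNReal.one_lt_top).ne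
  have hu' : (u : ℝ) ≤ 1 := by exact_mod_cast hu
  rw [lintegral_countable']
  simp_rw [poissonMeasure_singleton]
  -- After extracting `e^{-r(1-u)}`, the terms are the Poisson weights of mean `r u`, which sum to
  -- one.
  have h1 : ∀ k : ℕ, (u : ℝ≥0∞) ^ k * ENNReal.ofReal (Real.exp (-r) * r ^ k / k.factorial)
      = ENNReal.ofReal (Real.exp (-(r * (1 - u))) *
        (Real.exp (-((r * u : ℝ≥0) : ℝ)) * ((r * u : ℝ≥0) : ℝ) ^ k / k.factorial)) := by
    intro k
    rw [← ENNReal.ofReal_coe_nnreal, ← ENNReal.ofReal_pow (by positivity),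
      ← ENNReal.ofReal_mul (by positivity)]
    congr 1
    have : Real.exp (-(r : ℝ)) = Real.exp (-(r * (1 - u))) * Real.exp (-((r * u : ℝ≥0) : ℝ)) := by
      rw [← Real.exp_add]; congr 1; push_cast; ring
    rw [this]; push_cast; ring
  have hs := (hasSum_one_poissonMeasure (r * u)).mul_left (Real.exp (-(r * (1 - u))))
  simp_rw [h1]
  rw [← ENNReal.ofReal_tsum_of_nonneg (fun k => by positivity) hs.summable, hs.tsum_eq, mul_one,
    ← expNeg_ofReal (t := (r : ℝ) * (1 - u)) (mul_nonneg r.2 (by linarith)),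
    ENNReal.ofReal_mul r.coe_nonneg,
    ENNReal.ofReal_sub _ u.coe_nonneg]
  simp

lemma IsPoissonProcess.lintegral_expNeg_count [IsProbabilityMeasure P]
    (hX : IsPoissonProcess P X lam) (hlam : 0 ≤ lam)
    {A : Set Plane} (hA : MeasurableSet A) (hA' : volume A ≠ ∞) (c : ℝ≥0∞) :
    ∫⁻ ω, expNeg (c * (count X A ω : ℕ∞)) ∂P =
      expNeg (ENNReal.ofReal lam * ((1 - expNeg c) * volume A)) := by
  have h1 : ∫⁻ ω, expNeg (c * (count X A ω : ℕ∞)) ∂P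
      = ∫⁻ k : ℕ∞, expNeg (c * (k : ℝ≥0∞)) ∂(P.map (count X A)) :=
    (lintegral_map (measurable_of_countable fun k : ℕ∞ => expNeg (c * (k : ℝ≥0∞)))
      (measurable_count hX.measurable hA)).symm
  rw [h1, hX.map_count hA hA', lintegral_map (measurable_of_countable _) (measurable_of_countable _)]
  simp only [ENat.toENNReal_coe, expNeg_mul_natCast]
  rw [lintegral_pow_poissonMeasure _ (expNeg_le_one c)]
  congr 1
  rw [← ENNReal.ofReal, ENNReal.ofReal_mul hlam, ofReal_measureReal hA']
  ring

/-- The Laplace functional of a Poisson process at a simple function. -/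
lemma IsPoissonProcess.laplace_simpleFunc [IsProbabilityMeasure P]
    (hX : IsPoissonProcess P X lam) (hlam : 0 ≤ lam) (f : SimpleFunc Plane ℝ≥0∞)
    (hf : ∀ c ≠ 0, volume (f ⁻¹' {c}) ≠ ∞) :
    ∫⁻ ω, expNeg (∑' n, f (X n ω)) ∂P = expNeg (ENNReal.ofReal lam * lossIntegral f) := by
  classical
  -- The value 0 is dropped: it contributes nothing, and its level set may have infinite area.
  set s : Finset ℝ≥0∞ := f.range.filter (· ≠ 0) with hs
  have hne : ∀ c : s, (c : ℝ≥0∞) ≠ 0 := fun c => (Finset.mem_filter.1 c.2).2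
  have hind : iIndepFun (fun c : s => count X (f ⁻¹' {(c : ℝ≥0∞)})) P := by
    have h := hX.count_indep s.card (fun j => f ⁻¹' {(s.equivFin.symm j : ℝ≥0∞)})
      (fun j => f.measurableSet_preimage _) (fun j => hf _ (hne _)) (fun j l hjl => by
        refine Disjoint.preimage _ ?_
        rw [disjoint_singleton]
        exact fun h => hjl (s.equivFin.symm.injective (Subtype.ext h)))
    simpa using h.precomp s.equivFin.injective
  have hsum : ∀ ω, ∑' n, f (X n ω)
      = ∑ c : s, (c : ℝ≥0∞) * (count X (f ⁻¹' {(c : ℝ≥0∞)}) ω : ℕ∞) := by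
    intro ω
    have h1 : ∀ x, f x = ∑ c : s, (c : ℝ≥0∞) * (f ⁻¹' {(c : ℝ≥0∞)}).indicator (fun _ => 1) x := by
      intro x
      rw [Finset.sum_coe_sort s fun c => c * (f ⁻¹' {c}).indicator (fun _ => (1 : ℝ≥0∞)) x]
      by_cases h0 : f x = 0
      · rw [h0, eq_comm, Finset.sum_eq_zero]
        intro c hc
        have : c ≠ 0 := (Finset.mem_filter.1 hc).2
        rw [indicator_of_notMem (by simpa [h0] using this.symm), mul_zero]
      · rw [Finset.sum_eq_single_of_mem (f x) (by simp [hs, h0])]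
        · simp
        · intro c _ hc
          rw [indicator_of_notMem (by simpa using hc.symm), mul_zero]
    simp_rw [coe_count, ← ENNReal.tsum_mul_left]
    rw [← Summable.tsum_finsetSum fun _ _ => ENNReal.summable]
    exact tsum_congr fun n => h1 _
  have hloss : lossIntegral f = ∑ c : s, (1 - expNeg c) * volume (f ⁻¹' {(c : ℝ≥0∞)}) := by
    rw [Finset.sum_coe_sort s fun c => (1 - expNeg c) * volume (f ⁻¹' {c}), hs,
      Finset.sum_filter_of_ne]
    · rw [← SimpleFunc.map_lintegral (fun c => 1 - expNeg c) f,
        ← SimpleFunc.lintegral_eq_lintegral]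
      rfl
    · rintro c _ h rfl
      simp at h
  have hmeas : ∀ c : s, Measurable fun ω => (c : ℝ≥0∞) * (count X (f ⁻¹' {(c : ℝ≥0∞)}) ω : ℕ∞) :=
    fun c => (measurable_of_countable fun k : ℕ∞ => (c : ℝ≥0∞) * (k : ℝ≥0∞)).comp
      (measurable_count hX.measurable (f.measurableSet_preimage _))
  simp_rw [hsum]
  rw [lintegral_expNeg_sum hmeas (hind.comp (fun (c : s) (k : ℕ∞) => (c : ℝ≥0∞) * (k : ℝ≥0∞))
    fun _ => measurable_of_countable _), hloss, Finset.mul_sum, expNeg_sum]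
  exact Finset.prod_congr rfl fun c _ =>
    hX.lintegral_expNeg_count hlam (f.measurableSet_preimage _) (hf _ (hne c)) _

lemma tendsto_lossIntegral_of_monotone {F : ℕ → Plane → ℝ≥0∞} {f : Plane → ℝ≥0∞}
    (hF : ∀ k, Measurable (F k)) (hmono : ∀ x, Monotone fun k => F k x)
    (h : ∀ x, Tendsto (fun k => F k x) atTop (𝓝 (f x))) :
    Tendsto (fun k => lossIntegral (F k)) atTop (𝓝 (lossIntegral f)) := by
  refine lintegral_tendsto_of_tendsto_of_monotone
    (fun k => (measurable_const.sub (measurable_expNeg.comp (hF k))).aemeasurable)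
    (Eventually.of_forall fun x i j hij => tsub_le_tsub_left (expNeg_antitone (hmono x hij)) _)
    (Eventually.of_forall fun x => ?_)
  exact ENNReal.Tendsto.sub tendsto_const_nhds ((continuous_expNeg.tendsto _).comp (h x))
    (Or.inl ENNReal.one_ne_top)

/-- The Laplace functional of a homogeneous Poisson process. -/
theorem IsPoissonProcess.laplace [IsProbabilityMeasure P]
    (hX : IsPoissonProcess P X lam) (hlam : 0 ≤ lam) {f : Plane → ℝ≥0∞} (hf : Measurable f) :
    ∫⁻ ω, expNeg (∑' n, f (X n ω)) ∂P = expNeg (ENNReal.ofReal lam * lossIntegral f) := by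
  -- Cutting the simple approximations to growing balls keeps them monotone and gives their nonzero
  -- level sets finite area.
  let F : ℕ → SimpleFunc Plane ℝ≥0∞ := fun k =>
    (SimpleFunc.eapprox f k).restrict (Metric.ball 0 k)
  have hFx : ∀ k x, F k x = (Metric.ball 0 (k : ℝ)).indicator (SimpleFunc.eapprox f k) x :=
    fun k x => by rw [SimpleFunc.restrict_apply _ measurableSet_ball]
  have hmono : ∀ x, Monotone fun k => F k x := by
    intro x i j hij
    simp only [hFx]
    refine (indicator_le_indicator_of_subset (Metric.ball_subset_ball (by exact_mod_cast hij))
      (fun _ => zero_le) x).trans (indicator_le_indicator ?_)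
    exact SimpleFunc.monotone_eapprox f hij x
  have hlim : ∀ x, Tendsto (fun k => F k x) atTop (𝓝 (f x)) := by
    intro x
    refine (SimpleFunc.tendsto_eapprox hf x).congr' ?_
    obtain ⟨N, hN⟩ := exists_nat_gt ‖x‖
    filter_upwards [eventually_ge_atTop N] with k hk
    rw [hFx, indicator_of_mem]
    rw [mem_ball_zero_iff]
    exact hN.trans_le (by exact_mod_cast hk)
  have hfin : ∀ k, ∀ c ≠ 0, volume (F k ⁻¹' {c}) ≠ ∞ := by
    intro k c hc
    refine ne_top_of_le_ne_top (measure_ball_lt_top (x := (0 : Plane)) (r := k)).ne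
      (measure_mono fun x hx => ?_)
    by_contra hxb
    rw [mem_preimage, hFx, indicator_of_notMem hxb] at hx
    exact hc hx.symm
  have h1 : Tendsto (fun k => ∫⁻ ω, expNeg (∑' n, F k (X n ω)) ∂P) atTop
      (𝓝 (∫⁻ ω, expNeg (∑' n, f (X n ω)) ∂P)) :=
    tendsto_lintegral_expNeg
      (fun k => Measurable.tsum fun n => (F k).measurable.comp (hX.measurable n))
      (Eventually.of_forall fun ω => tendsto_tsum_of_monotone (fun n => hmono _) fun n => hlim _)
  refine tendsto_nhds_unique h1 ?_
  simp_rw [fun k => hX.laplace_simpleFunc hlam (F k) (hfin k)]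
  refine (continuous_expNeg.tendsto _).comp (ENNReal.Tendsto.const_mul ?_ (Or.inr ENNReal.ofReal_ne_top))
  exact tendsto_lossIntegral_of_monotone (fun k => (F k).measurable) hmono hlim

end Count

/-! ### The nearest point, and the process beyond it. -/

section Nearest

variable {Ω : Type*}

/-- The distance from the origin to the nearest point of the sequence `Y`. -/
noncomputable def nearDist (Y : ℕ → Ω → Plane) (ω : Ω) : ℝ := ⨅ n, ‖Y n ω‖

lemma nearDist_le (Y : ℕ → Ω → Plane) (ω : Ω) (n : ℕ) : nearDist Y ω ≤ ‖Y n ω‖ :=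
  ciInf_le ⟨0, by rintro _ ⟨m, rfl⟩; positivity⟩ n

lemma nearDist_nonneg (Y : ℕ → Ω → Plane) (ω : Ω) : 0 ≤ nearDist Y ω :=
  le_ciInf fun _ => norm_nonneg _

lemma le_nearDist_iff (Y : ℕ → Ω → Plane) (ω : Ω) (a : ℝ) :
    a ≤ nearDist Y ω ↔ ∀ n, a ≤ ‖Y n ω‖ :=
  ⟨fun h n => h.trans (nearDist_le Y ω n), fun h => le_ciInf h⟩

/-- An infinite weight on the disc makes `expNeg` of the sum the indicator that the disc is empty,
so void events are covered by the Laplace functional. -/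
lemma expNeg_tsum_ball (Y : ℕ → Ω → Plane) (ω : Ω) (a : ℝ) :
    expNeg (∑' n, (Metric.ball (0 : Plane) a).indicator (fun _ => ∞) (Y n ω)) =
      {ω | a ≤ nearDist Y ω}.indicator 1 ω := by
  by_cases h : a ≤ nearDist Y ω
  · rw [indicator_of_mem (by exact h)]
    rw [le_nearDist_iff] at h
    have : ∀ n, (Metric.ball (0 : Plane) a).indicator (fun _ => (∞ : ℝ≥0∞)) (Y n ω) = 0 :=
      fun n => indicator_of_notMem (by simpa using h n) _
    simp [this]
  · rw [indicator_of_notMem (by exact h)]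
    rw [le_nearDist_iff] at h
    push Not at h
    obtain ⟨n, hn⟩ := h
    rw [ENNReal.tsum_eq_top_of_eq_top ⟨n, indicator_of_mem (by simpa using hn) _⟩, expNeg_top]

variable [MeasurableSpace Ω] {P : Measure Ω} {Y : ℕ → Ω → Plane} {lam : ℝ}

lemma measurable_nearDist (hY : ∀ n, Measurable (Y n)) : Measurable (nearDist Y) :=
  Measurable.iInf fun n => (hY n).norm

lemma lossIntegral_ball_add {a : ℝ} {f : Plane → ℝ≥0∞} (h0 : ∀ x, ‖x‖ < a → f x = 0) :
    lossIntegral (fun x => (Metric.ball (0 : Plane) a).indicator (fun _ => ∞) x + f x) =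
      volume (Metric.ball (0 : Plane) a) + lossIntegral f := by
  rw [lossIntegral, lossIntegral, ← lintegral_indicator_one measurableSet_ball,
    ← lintegral_add_left (measurable_one.indicator measurableSet_ball)]
  refine lintegral_congr fun x => ?_
  by_cases hx : x ∈ Metric.ball (0 : Plane) a
  · simp [hx, h0 x (by simpa using hx)]
  · simp [hx]

/-- Apply the Laplace functional to `f` plus an infinite weight on the disc. As `f` vanishes on the
disc, the two loss integrals add and the exponential factors. -/
lemma IsPoissonProcess.setLIntegral_le_nearDist [IsProbabilityMeasure P]
    (hY : IsPoissonProcess P Y lam) (hlam : 0 ≤ lam)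
    {a : ℝ} {f : Plane → ℝ≥0∞} (hf : Measurable f) (h0 : ∀ x, ‖x‖ < a → f x = 0) :
    ∫⁻ ω in {ω | a ≤ nearDist Y ω}, expNeg (∑' n, f (Y n ω)) ∂P =
      expNeg (ENNReal.ofReal lam * volume (Metric.ball (0 : Plane) a)) *
        expNeg (ENNReal.ofReal lam * lossIntegral f) := by
  have hm : MeasurableSet {ω | a ≤ nearDist Y ω} :=
    measurableSet_le measurable_const (measurable_nearDist hY.measurable)
  rw [← lintegral_indicator hm, ← expNeg_add, ← mul_add, ← lossIntegral_ball_add h0,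
    ← hY.laplace (f := fun x => (Metric.ball (0 : Plane) a).indicator (fun _ => ∞) x + f x) hlam
      ((measurable_const.indicator measurableSet_ball).add hf)]
  refine lintegral_congr fun ω => ?_
  rw [ENNReal.tsum_add, expNeg_add, expNeg_tsum_ball]
  by_cases h : a ≤ nearDist Y ω <;> simp [h]

lemma IsPoissonProcess.measure_le_nearDist [IsProbabilityMeasure P]
    (hY : IsPoissonProcess P Y lam) (hlam : 0 ≤ lam)
    (a : ℝ) : P {ω | a ≤ nearDist Y ω} =
      expNeg (ENNReal.ofReal lam * volume (Metric.ball (0 : Plane) a)) := by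
  simpa [lossIntegral] using
    hY.setLIntegral_le_nearDist hlam (a := a) (f := fun _ => 0) measurable_const fun _ _ => rfl

/-- The event that the nearest point is at distance between `a` and `b` is independent of the
points at distance at least `b`. -/
lemma IsPoissonProcess.setLIntegral_nearDist_mem_Ico [IsProbabilityMeasure P]
    (hY : IsPoissonProcess P Y lam)
    (hlam : 0 ≤ lam) {a b : ℝ} (hab : a ≤ b) {f : Plane → ℝ≥0∞} (hf : Measurable f)
    (h0 : ∀ x, ‖x‖ < b → f x = 0) :
    ∫⁻ ω in {ω | nearDist Y ω ∈ Ico a b}, expNeg (∑' n, f (Y n ω)) ∂P =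
      ∫⁻ _ in {ω | nearDist Y ω ∈ Ico a b}, expNeg (ENNReal.ofReal lam * lossIntegral f) ∂P := by
  have hm : ∀ c, MeasurableSet {ω | c ≤ nearDist Y ω} := fun c =>
    measurableSet_le measurable_const (measurable_nearDist hY.measurable)
  have hsub : {ω | b ≤ nearDist Y ω} ⊆ {ω | a ≤ nearDist Y ω} := fun ω h => hab.trans h
  -- The event is a difference of two void events. Since `f` vanishes on both discs, the same factor
  -- `expNeg (λ * lossIntegral f)` comes out of both terms.
  have hdiff : {ω | nearDist Y ω ∈ Ico a b} = {ω | a ≤ nearDist Y ω} \ {ω | b ≤ nearDist Y ω} := by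
    ext ω; simp
  have hfin : ∀ s : Set Ω, ∫⁻ ω in s, expNeg (∑' n, f (Y n ω)) ∂P ≠ ∞ := fun s =>
    ne_top_of_le_ne_top ENNReal.one_ne_top
      ((setLIntegral_le_lintegral _ _).trans (lintegral_expNeg_le_one _))
  rw [lintegral_const, Measure.restrict_apply_univ, hdiff,
    measure_sdiff hsub (hm b).nullMeasurableSet (measure_ne_top _ _),
    hY.measure_le_nearDist hlam, hY.measure_le_nearDist hlam,
    ENNReal.mul_sub fun _ _ => expNeg_ne_top _, mul_comm (expNeg (_ * lossIntegral f)),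
    mul_comm (expNeg (_ * lossIntegral f)),
    ← hY.setLIntegral_le_nearDist hlam hf fun x hx => h0 x (hx.trans_le hab),
    ← hY.setLIntegral_le_nearDist hlam hf h0]
  refine ENNReal.eq_sub_of_add_eq (hfin _) ?_
  rw [add_comm, ← lintegral_inter_add_sdiff _ {ω | a ≤ nearDist Y ω} (hm b),
    inter_eq_self_of_subset_right hsub]

lemma lintegral_eq_tsum_preimage {N : Ω → ℕ} (hN : Measurable N) (f : Ω → ℝ≥0∞) :
    ∫⁻ ω, f ω ∂P = ∑' j, ∫⁻ ω in N ⁻¹' {j}, f ω ∂P := by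
  rw [← lintegral_iUnion (fun j => hN (measurableSet_singleton j)), ← preimage_iUnion,
    iUnion_of_singleton, preimage_univ, setLIntegral_univ]
  intro i j hij
  exact Disjoint.preimage _ (disjoint_singleton.2 hij)

/-- `⌊2^k r⌋ / 2^k`. -/
noncomputable def dyadicFloor (k : ℕ) (r : ℝ) : ℝ := ⌊2 ^ k * r⌋₊ / 2 ^ k

lemma dyadicFloor_le (k : ℕ) {r : ℝ} (hr : 0 ≤ r) : dyadicFloor k r ≤ r := by
  rw [dyadicFloor, div_le_iff₀ (by positivity), mul_comm r]
  exact Nat.floor_le (by positivity)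

lemma lt_dyadicFloor_add (k : ℕ) (r : ℝ) : r < dyadicFloor k r + 1 / 2 ^ k := by
  rw [dyadicFloor, ← add_div, lt_div_iff₀ (by positivity), mul_comm r]
  exact Nat.lt_floor_add_one _

lemma dyadicFloor_mono {r : ℝ} (hr : 0 ≤ r) : Monotone fun k => dyadicFloor k r := by
  refine monotone_nat_of_le_succ fun k => ?_
  simp only [dyadicFloor]
  rw [div_le_div_iff₀ (by positivity) (by positivity), pow_succ, mul_comm (2 ^ k : ℝ) 2, ← mul_assoc]
  refine mul_le_mul_of_nonneg_right ?_ (by positivity)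
  have h := Nat.floor_le (show (0 : ℝ) ≤ 2 ^ k * r by positivity)
  have : ⌊(2 : ℝ) ^ k * r⌋₊ * 2 ≤ ⌊2 * 2 ^ k * r⌋₊ := by
    refine Nat.le_floor ?_
    push_cast
    linarith
  exact_mod_cast this

/-- Together with `dyadicFloor_mono`: both ends of the dyadic cell of `r` close in monotonically as
the mesh is refined, as monotone convergence in `lintegral_nearest` requires. -/
lemma dyadicFloor_add_antitone {r : ℝ} (hr : 0 ≤ r) :
    Antitone fun k => dyadicFloor k r + 1 / 2 ^ k := by
  refine antitone_nat_of_succ_le fun k => ?_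
  simp only [dyadicFloor]
  rw [← add_div, ← add_div, div_le_div_iff₀ (by positivity) (by positivity), pow_succ,
    mul_comm (2 ^ k : ℝ) 2, ← mul_assoc]
  refine mul_le_mul_of_nonneg_right ?_ (by positivity)
  have h := Nat.lt_floor_add_one ((2 : ℝ) ^ k * r)
  have : ⌊2 * 2 ^ k * r⌋₊ < (⌊(2 : ℝ) ^ k * r⌋₊ + 1) * 2 := by
    rw [Nat.floor_lt (by positivity)]
    push_cast
    linarith
  exact_mod_cast this

lemma tendsto_dyadicFloor {r : ℝ} (hr : 0 ≤ r) :
    Tendsto (fun k => dyadicFloor k r) atTop (𝓝 r) := by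
  have h1 : Tendsto (fun k : ℕ => r - 1 / 2 ^ k) atTop (𝓝 r) := by
    have := (tendsto_pow_atTop_nhds_zero_of_lt_one (r := (1 / 2 : ℝ)) (by norm_num)
      (by norm_num)).const_sub r
    simpa [one_div] using this
  exact tendsto_of_tendsto_of_tendsto_of_le_of_le h1 tendsto_const_nhds
    (fun k => by have := lt_dyadicFloor_add k r; simp only; linarith)
    fun k => dyadicFloor_le k hr

lemma dyadicFloor_eq_iff {k j : ℕ} {r : ℝ} (hr : 0 ≤ r) :
    ⌊2 ^ k * r⌋₊ = j ↔ r ∈ Ico ((j : ℝ) / 2 ^ k) (j / 2 ^ k + 1 / 2 ^ k) := by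
  rw [Nat.floor_eq_iff (by positivity), mem_Ico, ← add_div, div_le_iff₀ (by positivity),
    lt_div_iff₀ (by positivity), mul_comm r]

/-- Conditionally on the distance `R` of its nearest point, a Poisson process outside the disc of
radius `R` is a Poisson process. -/
theorem IsPoissonProcess.lintegral_nearest [IsProbabilityMeasure P]
    (hY : IsPoissonProcess P Y lam) (hlam : 0 ≤ lam)
    {g : ℝ → ℝ≥0∞} (hg : Continuous g) {F : ℝ → Plane → ℝ≥0∞} (hF : ∀ r, Measurable (F r))
    (hFmono : ∀ x, Monotone fun r => F r x) (hFcont : ∀ x ≠ 0, Continuous fun r => F r x) :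
    ∫⁻ ω, expNeg (g (nearDist Y ω) +
        ∑' n, {x : Plane | nearDist Y ω < ‖x‖}.indicator (F (nearDist Y ω)) (Y n ω)) ∂P =
      ∫⁻ ω, expNeg (g (nearDist Y ω) + ENNReal.ofReal lam *
        lossIntegral ({x : Plane | nearDist Y ω < ‖x‖}.indicator (F (nearDist Y ω)))) ∂P := by
  set R := nearDist Y with hR
  have hRm : Measurable R := measurable_nearDist hY.measurable
  have hR0 : ∀ ω, 0 ≤ R ω := nearDist_nonneg Y
  -- On cell `j` the parameter of `F` is the lower end and the cutoff is the upper end. Both choices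
  -- make `f` increase with `k`, and the upper cutoff leaves only points whose configuration is
  -- independent of the cell event.
  let f : ℕ → ℕ → Plane → ℝ≥0∞ := fun k j =>
    {x : Plane | (j : ℝ) / 2 ^ k + 1 / 2 ^ k ≤ ‖x‖}.indicator (F (j / 2 ^ k))
  let N : ℕ → Ω → ℕ := fun k ω => ⌊2 ^ k * R ω⌋₊
  have hNR : ∀ k ω, (N k ω : ℝ) / 2 ^ k = dyadicFloor k (R ω) := fun _ _ => rfl
  have hf_in : ∀ (k j : ℕ) (x : Plane), (j : ℝ) / 2 ^ k + 1 / 2 ^ k ≤ ‖x‖ → f k j x = F (j / 2 ^ k) x := by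
    intro k j x hx
    exact indicator_of_mem (s := {x : Plane | _ ≤ ‖x‖}) hx _
  have hf_out : ∀ (k j : ℕ) (x : Plane), ‖x‖ < (j : ℝ) / 2 ^ k + 1 / 2 ^ k → f k j x = 0 := by
    intro k j x hx
    exact indicator_of_notMem (s := {x : Plane | _ ≤ ‖x‖}) (not_le.2 hx) _
  have hN : ∀ k, Measurable (N k) := fun k => Nat.measurable_floor.comp (hRm.const_mul _)
  have hfm : ∀ k j, Measurable (f k j) := fun k j => (hF _).indicator (measurableSet_le measurable_const measurable_norm)
  have hset : ∀ k j, N k ⁻¹' {j} =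
      {ω | R ω ∈ Ico ((j : ℝ) / 2 ^ k) (j / 2 ^ k + 1 / 2 ^ k)} := fun k j => by
    ext ω
    exact dyadicFloor_eq_iff (hR0 ω)
  clear_value f N
  have hmono : ∀ ω x, Monotone fun k => f k (N k ω) x := by
    intro ω x i j hij
    change f i (N i ω) x ≤ f j (N j ω) x
    rcases le_or_gt ((N i ω : ℝ) / 2 ^ i + 1 / 2 ^ i) ‖x‖ with hx | hx
    · have hx' : (N j ω : ℝ) / 2 ^ j + 1 / 2 ^ j ≤ ‖x‖ := by
        rw [hNR] at hx ⊢
        exact (dyadicFloor_add_antitone (hR0 ω) hij).trans hx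
      rw [hf_in _ _ _ hx, hf_in _ _ _ hx', hNR, hNR]
      exact hFmono x (dyadicFloor_mono (hR0 ω) hij)
    · rw [hf_out _ _ _ hx]
      exact zero_le
  have hlim : ∀ ω x, Tendsto (fun k => f k (N k ω) x) atTop
      (𝓝 ({x : Plane | R ω < ‖x‖}.indicator (F (R ω)) x)) := by
    intro ω x
    by_cases hx : R ω < ‖x‖
    · have hx0 : x ≠ 0 := norm_pos_iff.1 ((hR0 ω).trans_lt hx)
      rw [indicator_of_mem (by exact hx)]
      have h1 : Tendsto (fun k => dyadicFloor k (R ω) + 1 / 2 ^ k) atTop (𝓝 (R ω)) := by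
        have := (tendsto_dyadicFloor (hR0 ω)).add (tendsto_pow_atTop_nhds_zero_of_lt_one
          (r := (1 / 2 : ℝ)) (by norm_num) (by norm_num))
        simpa [one_div] using this
      refine (((hFcont x hx0).tendsto _).comp (tendsto_dyadicFloor (hR0 ω))).congr' ?_
      filter_upwards [h1.eventually_le_const hx] with k hk
      rw [hf_in _ _ _ (by rwa [hNR]), hNR, Function.comp_apply]
    · rw [indicator_of_notMem (by exact hx)]
      refine tendsto_const_nhds.congr fun k => (hf_out _ _ _ ?_).symm
      rw [hNR]
      exact (not_lt.1 hx).trans_lt (lt_dyadicFloor_add k (R ω))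
  have hglim : ∀ ω, Tendsto (fun k => g ((N k ω : ℝ) / 2 ^ k)) atTop (𝓝 (g (R ω))) := fun ω => by
    simp_rw [hNR]
    exact (hg.tendsto _).comp (tendsto_dyadicFloor (hR0 ω))
  have hgm : ∀ k, Measurable fun ω => g ((N k ω : ℝ) / 2 ^ k) := fun k =>
    (measurable_of_countable fun j : ℕ => g ((j : ℝ) / 2 ^ k)).comp (hN k)
  have h1 : Tendsto (fun k => ∫⁻ ω, expNeg (g ((N k ω : ℝ) / 2 ^ k) +
      ∑' n, f k (N k ω) (Y n ω)) ∂P) atTop (𝓝 (∫⁻ ω, expNeg (g (R ω) +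
        ∑' n, {x : Plane | R ω < ‖x‖}.indicator (F (R ω)) (Y n ω)) ∂P)) := by
    refine tendsto_lintegral_expNeg (fun k => (hgm k).add (Measurable.tsum fun n => ?_))
      (Eventually.of_forall fun ω => (hglim ω).add
        (tendsto_tsum_of_monotone (fun n => hmono ω _) fun n => hlim ω _))
    have hu : Measurable (Function.uncurry (f k)) := measurable_from_prod_countable_right (hfm k)
    exact hu.comp ((hN k).prodMk (hY.measurable n))
  have h2 : Tendsto (fun k => ∫⁻ ω, expNeg (g ((N k ω : ℝ) / 2 ^ k) +
      ENNReal.ofReal lam * lossIntegral (f k (N k ω))) ∂P) atTop (𝓝 (∫⁻ ω, expNeg (g (R ω) +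
        ENNReal.ofReal lam * lossIntegral ({x : Plane | R ω < ‖x‖}.indicator (F (R ω)))) ∂P)) := by
    refine tendsto_lintegral_expNeg (fun k => (hgm k).add ?_) (Eventually.of_forall fun ω =>
      (hglim ω).add (ENNReal.Tendsto.const_mul (tendsto_lossIntegral_of_monotone
        (fun k => hfm k _) (hmono ω) (hlim ω)) (Or.inr ENNReal.ofReal_ne_top)))
    exact (measurable_of_countable fun j : ℕ =>
      ENNReal.ofReal lam * lossIntegral (f k j)).comp (hN k)
  -- At a fixed level both sides split over the cells. On a cell `g` is constant and `f k j`
  -- vanishes below the upper end, so `setLIntegral_nearDist_mem_Ico` gives equality cell by cell.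
  refine tendsto_nhds_unique h1 (h2.congr fun k => ?_)
  rw [lintegral_eq_tsum_preimage (hN k), lintegral_eq_tsum_preimage (hN k)]
  refine tsum_congr fun j => ?_
  have hms : MeasurableSet (N k ⁻¹' {j}) := hN k (measurableSet_singleton j)
  have hcongr : ∀ H : ℕ → Ω → ℝ≥0∞, ∫⁻ ω in N k ⁻¹' {j}, H (N k ω) ω ∂P
      = ∫⁻ ω in N k ⁻¹' {j}, H j ω ∂P := fun H =>
    setLIntegral_congr_fun hms fun ω hω => by rw [show N k ω = j from hω]
  rw [hcongr fun j ω => expNeg (g ((j : ℝ) / 2 ^ k) + ENNReal.ofReal lam * lossIntegral (f k j)),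
    hcongr fun j ω => expNeg (g ((j : ℝ) / 2 ^ k) + ∑' n, f k j (Y n ω))]
  simp_rw [expNeg_add]
  rw [lintegral_const_mul' _ _ (expNeg_ne_top _), lintegral_const_mul' _ _ (expNeg_ne_top _), hset]
  congr 1
  refine (hY.setLIntegral_nearDist_mem_Ico hlam (le_add_of_nonneg_right (by positivity)) (hfm k j)
    (hf_out k j)).symm

end Nearest

/-! ### Almost sure properties: distinct distances, a nearest point, no point at the origin. -/

section Simple

variable {Ω : Type*} [MeasurableSpace Ω] {P : Measure Ω} [IsProbabilityMeasure P]
  {Y : ℕ → Ω → Plane} {lam : ℝ}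

/-- With mean `r` the probability is `1 - e^{-r}(1 + r)`, and `e^{-r} ≥ 1 - r` bounds it by `r²`. -/
lemma IsPoissonProcess.measure_two_le_count (hY : IsPoissonProcess P Y lam) (hlam : 0 ≤ lam)
    {A : Set Plane} (hA : MeasurableSet A) (hA' : volume A ≠ ∞) :
    P {ω | 2 ≤ count Y A ω} ≤ ENNReal.ofReal ((lam * volume.real A) ^ 2) := by
  set r : ℝ≥0 := (lam * volume.real A).toNNReal with hr
  have hrc : (r : ℝ) = lam * volume.real A := Real.coe_toNNReal _ (by positivity)
  have h1 : P {ω | 2 ≤ count Y A ω} = poissonMeasure r {k : ℕ | 2 ≤ k} := by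
    have h2 := congrArg (fun μ : Measure ℕ∞ => μ {k | 2 ≤ k}) (hY.map_count hA hA')
    rw [Measure.map_apply (measurable_count hY.measurable hA) MeasurableSet.of_discrete,
      Measure.map_apply (measurable_of_countable _) MeasurableSet.of_discrete] at h2
    refine h2.trans ?_
    congr 1
    ext k
    simp only [mem_preimage, mem_ofPred_eq]
    norm_cast
  have h3 : ({k : ℕ | 2 ≤ k} : Set ℕ) = ({0} ∪ {1})ᶜ := by
    ext k
    simp only [mem_ofPred_eq, mem_compl_iff, mem_union, mem_singleton_iff]
    omega
  rw [h1, h3, ← ofReal_measureReal, ← hrc]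
  refine ENNReal.ofReal_le_ofReal ?_
  rw [probReal_compl_eq_one_sub MeasurableSet.of_discrete,
    measureReal_union (by simp) MeasurableSet.of_discrete, poissonMeasure_real_singleton,
    poissonMeasure_real_singleton]
  have h4 : 1 - (r : ℝ) ≤ Real.exp (-r) := by linarith [Real.add_one_le_exp (-(r : ℝ))]
  simp only [pow_zero, pow_one, Nat.factorial_zero, Nat.factorial_one, Nat.cast_one, mul_one,
    div_one]
  nlinarith [mul_le_mul_of_nonneg_right h4 (show (0 : ℝ) ≤ 1 + r by positivity)]

lemma volume_normSq_mem_Ico {a c : ℝ} (ha : 0 ≤ a) (hc : 0 ≤ c) :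
    MeasurableSet {x : Plane | ‖x‖ ^ 2 ∈ Ico a (a + c)} ∧
      volume {x : Plane | ‖x‖ ^ 2 ∈ Ico a (a + c)} = ENNReal.ofReal (Real.pi * c) := by
  have hball : ∀ b, 0 ≤ b → {x : Plane | ‖x‖ ^ 2 < b} = Metric.ball 0 (√b) := by
    intro b hb
    ext x
    rw [mem_ofPred_eq, mem_ball_zero_iff, Real.lt_sqrt (norm_nonneg _)]
  have hvol : ∀ b, 0 ≤ b → volume (Metric.ball (0 : Plane) (√b)) = ENNReal.ofReal (Real.pi * b) := by
    intro b hb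
    rw [EuclideanSpace.volume_ball_fin_two, ← ENNReal.ofReal_pow (Real.sqrt_nonneg _),
      Real.sq_sqrt hb, ← ENNReal.ofReal_mul hb, mul_comm]
  have hset : {x : Plane | ‖x‖ ^ 2 ∈ Ico a (a + c)} =
      Metric.ball 0 (√(a + c)) \ Metric.ball 0 (√a) := by
    rw [← hball _ ha, ← hball _ (add_nonneg ha hc)]
    ext x
    simp [and_comm]
  rw [hset]
  refine ⟨measurableSet_ball.diff measurableSet_ball, ?_⟩
  rw [measure_sdiff (Metric.ball_subset_ball (Real.sqrt_le_sqrt (by linarith)))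
    measurableSet_ball.nullMeasurableSet measure_ball_lt_top.ne, hvol _ ha,
    hvol _ (add_nonneg ha hc), ← ENNReal.ofReal_sub _ (by positivity)]
  congr 1
  ring

/-- Almost surely no two points of a Poisson process are at the same distance from the origin. -/
lemma IsPoissonProcess.ae_norm_injective (hY : IsPoissonProcess P Y lam) (hlam : 0 ≤ lam) :
    ∀ᵐ ω ∂P, Function.Injective fun n => ‖Y n ω‖ := by
  have key : ∀ T : ℕ, P {ω | ∃ n m, n ≠ m ∧ ‖Y n ω‖ = ‖Y m ω‖ ∧ ‖Y n ω‖ ^ 2 < T} = 0 := by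
    intro T
    set C : ℝ := (lam * (Real.pi * T)) ^ 2 with hC
    -- Cut the disc into `N + 1` annuli of equal area, that is, of equal width in the squared norm.
    -- Two points at the same distance share an annulus, so the union bound gives `(N + 1) (λπT/(N +
    -- 1))²`, which tends to zero.
    have hbound : ∀ N : ℕ, P {ω | ∃ n m, n ≠ m ∧ ‖Y n ω‖ = ‖Y m ω‖ ∧ ‖Y n ω‖ ^ 2 < T}
        ≤ ENNReal.ofReal (C / ((N : ℝ) + 1)) := by
      intro N
      rcases Nat.eq_zero_or_pos T with rfl | hT
      · have : {ω | ∃ n m, n ≠ m ∧ ‖Y n ω‖ = ‖Y m ω‖ ∧ ‖Y n ω‖ ^ 2 < (0 : ℕ)} = ∅ := by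
          ext ω
          simp only [mem_ofPred_eq, mem_empty_iff_false, iff_false]
          rintro ⟨n, m, -, -, h⟩
          exact absurd h (by simp)
        rw [this]
        simp
      set c : ℝ := T / ((N : ℝ) + 1) with hc
      have hc0 : 0 < c := by positivity
      let A : ℕ → Set Plane := fun j => {x : Plane | ‖x‖ ^ 2 ∈ Ico (j * c) (j * c + c)}
      have hA : ∀ j, MeasurableSet (A j) ∧ volume (A j) = ENNReal.ofReal (Real.pi * c) := fun j =>
        volume_normSq_mem_Ico (by positivity) hc0.le
      have hsub : {ω | ∃ n m, n ≠ m ∧ ‖Y n ω‖ = ‖Y m ω‖ ∧ ‖Y n ω‖ ^ 2 < T} ⊆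
          ⋃ j ∈ Finset.range (N + 1), {ω | 2 ≤ count Y (A j) ω} := by
        rintro ω ⟨n, m, hnm, hn, hT'⟩
        have hfl : ‖Y n ω‖ ^ 2 ∈ Ico (⌊‖Y n ω‖ ^ 2 / c⌋₊ * c) (⌊‖Y n ω‖ ^ 2 / c⌋₊ * c + c) := by
          constructor
          · rw [← le_div_iff₀ hc0]
            exact Nat.floor_le (by positivity)
          · rw [← add_one_mul, ← div_lt_iff₀ hc0]
            exact Nat.lt_floor_add_one _
        refine mem_biUnion (x := ⌊‖Y n ω‖ ^ 2 / c⌋₊) ?_ ?_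
        · rw [Finset.mem_coe, Finset.mem_range, Nat.floor_lt (by positivity), div_lt_iff₀ hc0, hc]
          push_cast
          rwa [mul_div_cancel₀ _ (by positivity)]
        · have h2 : ({n, m} : Set ℕ) ⊆ {k | Y k ω ∈ A ⌊‖Y n ω‖ ^ 2 / c⌋₊} := by
            rintro k (rfl | rfl)
            · exact hfl
            · rw [hn] at hfl
              rw [hn]
              exact hfl
          have h3 := encard_le_encard h2
          rwa [encard_pair hnm] at h3
      calc P _ ≤ P (⋃ j ∈ Finset.range (N + 1), {ω | 2 ≤ count Y (A j) ω}) := measure_mono hsub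
        _ ≤ ∑ j ∈ Finset.range (N + 1), P {ω | 2 ≤ count Y (A j) ω} :=
          measure_biUnion_finset_le _ _
        _ ≤ ∑ j ∈ Finset.range (N + 1), ENNReal.ofReal ((lam * (Real.pi * c)) ^ 2) := by
          refine Finset.sum_le_sum fun j _ => ?_
          have := hY.measure_two_le_count hlam (hA j).1 (by rw [(hA j).2]; exact ENNReal.ofReal_ne_top)
          rwa [measureReal_def, (hA j).2, ENNReal.toReal_ofReal (by positivity)] at this
        _ = ENNReal.ofReal (C / ((N : ℝ) + 1)) := by
          rw [Finset.sum_const, Finset.card_range, nsmul_eq_mul, ← ENNReal.ofReal_natCast,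
            ← ENNReal.ofReal_mul (by positivity)]
          congr 1
          rw [hC, hc]
          push_cast
          field_simp
    have hlim : Tendsto (fun N : ℕ => ENNReal.ofReal (C / ((N : ℝ) + 1))) atTop (𝓝 0) := by
      have : Tendsto (fun N : ℕ => C / ((N : ℝ) + 1)) atTop (𝓝 0) :=
        tendsto_const_nhds.div_atTop (tendsto_atTop_add_const_right _ _ tendsto_natCast_atTop_atTop)
      simpa using ENNReal.tendsto_ofReal this
    exact le_antisymm (ge_of_tendsto' hlim hbound) zero_le
  have hall : ∀ᵐ ω ∂P, ∀ T : ℕ, ¬ ∃ n m, n ≠ m ∧ ‖Y n ω‖ = ‖Y m ω‖ ∧ ‖Y n ω‖ ^ 2 < T := by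
    rw [ae_all_iff]
    intro T
    rw [ae_iff]
    simpa using key T
  filter_upwards [hall] with ω hω n m hnm
  by_contra hne
  obtain ⟨T, hT⟩ := exists_nat_gt (‖Y n ω‖ ^ 2)
  exact hω T ⟨n, m, hne, hnm, hT⟩

/-- Almost surely some point of a Poisson process is nearest to the origin. -/
lemma IsPoissonProcess.ae_exists_nearest (hY : IsPoissonProcess P Y lam) :
    ∀ᵐ ω ∂P, ∃ n, ∀ m, ‖Y n ω‖ ≤ ‖Y m ω‖ := by
  have hall : ∀ᵐ ω ∂P, ∀ T : ℕ, count Y (Metric.ball 0 T) ω ≠ ⊤ := by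
    rw [ae_all_iff]
    intro T
    rw [ae_iff]
    simp only [not_not]
    have h2 := congrArg (fun μ : Measure ℕ∞ => μ {⊤})
      (hY.map_count (A := Metric.ball 0 T) measurableSet_ball measure_ball_lt_top.ne)
    rw [Measure.map_apply (measurable_count hY.measurable measurableSet_ball)
      MeasurableSet.of_discrete, Measure.map_apply (measurable_of_countable _)
      MeasurableSet.of_discrete] at h2
    refine h2.trans ?_
    have : (fun k : ℕ => (k : ℕ∞)) ⁻¹' {⊤} = ∅ := by
      ext k
      simp
    rw [this, measure_empty]
  filter_upwards [hall] with ω hω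
  -- The disc of radius `T` holds finitely many points and at least `Y 0`, so a minimum over it
  -- exists, and points outside are farther.
  obtain ⟨T, hT⟩ := exists_nat_gt ‖Y 0 ω‖
  have hfin : {n | Y n ω ∈ Metric.ball (0 : Plane) T}.Finite := by
    rw [← encard_ne_top_iff]
    exact hω T
  obtain ⟨n, hn, hmin⟩ := exists_min_image _ (fun n => ‖Y n ω‖) hfin
    ⟨0, by simpa using hT⟩
  refine ⟨n, fun m => ?_⟩
  by_cases hm : Y m ω ∈ Metric.ball (0 : Plane) T
  · exact hmin m hm
  · have hn' : ‖Y n ω‖ < T := by simpa using hn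
    have hm' : T ≤ ‖Y m ω‖ := by simpa using hm
    exact hn'.le.trans hm'

/-- Almost surely the origin is not a point of a Poisson process. -/
lemma IsPoissonProcess.ae_ne_zero (hY : IsPoissonProcess P Y lam) :
    ∀ᵐ ω ∂P, ∀ n, Y n ω ≠ 0 := by
  -- A single point has area zero, so its count is Poisson with mean zero.
  have h := hY.count_law {0} (measurableSet_singleton _) (by simp) 0
  simp only [measureReal_def, measure_singleton, ENNReal.toReal_zero, mul_zero,
    Real.toNNReal_zero] at h
  rw [poissonMeasure_singleton] at h
  have hm : MeasurableSet {ω | count Y {0} ω = (0 : ℕ)} :=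
    measurable_count hY.measurable (measurableSet_singleton (0 : Plane))
      (t := {((0 : ℕ) : ℕ∞)}) MeasurableSet.of_discrete
  have hae : ∀ᵐ ω ∂P, count Y {0} ω = (0 : ℕ) := by
    refine (mem_ae_iff_prob_eq_one hm).2 (h.trans ?_)
    simp
  filter_upwards [hae] with ω hω n hn
  rw [count, Nat.cast_zero, encard_eq_zero] at hω
  exact (eq_empty_iff_forall_notMem.1 hω n) (by simpa using hn)

end Simple

/-! ### Exponential variables. -/

section Exponential

lemma expMeasure_Ioi {t : ℝ} (ht : 0 ≤ t) :
    expMeasure 1 (Ioi t) = ENNReal.ofReal (Real.exp (-t)) := by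
  have : IsProbabilityMeasure (expMeasure 1) := isProbabilityMeasure_expMeasure one_pos
  have h := cdf_expMeasure_eq (r := 1) one_pos t
  rw [if_pos ht, one_mul, cdf_eq_real] at h
  rw [← compl_Iic, ← ofReal_measureReal, probReal_compl_eq_one_sub measurableSet_Iic, h, sub_sub_cancel]

lemma expMeasure_singleton (t : ℝ) : expMeasure 1 {t} = 0 :=
  withDensity_absolutelyContinuous _ _ (by simp)

lemma expMeasure_Ici {t : ℝ} (ht : 0 ≤ t) :
    expMeasure 1 (Ici t) = ENNReal.ofReal (Real.exp (-t)) := by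
  rw [← expMeasure_Ioi ht, ← Ioi_union_left]
  refine le_antisymm ((measure_union_le _ _).trans ?_) (measure_mono subset_union_left)
  rw [expMeasure_singleton, add_zero]

/-- The integrand against the Exp(1) density is `1/(1 + c)` times the density of rate `1 + c`. For
`c = ∞` the convention `∞ * 0 = 0` must be avoided, hence the restriction to `x > 0`. -/
lemma lintegral_expNeg_mul_expMeasure (c : ℝ≥0∞) :
    ∫⁻ x, expNeg (c * ENNReal.ofReal x) ∂(expMeasure 1) = (1 + c)⁻¹ := by
  have hpos : ∀ᵐ x ∂(expMeasure 1), 0 < x := by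
    have : IsProbabilityMeasure (expMeasure 1) := isProbabilityMeasure_expMeasure one_pos
    refine (mem_ae_iff_prob_eq_one measurableSet_Ioi).2 ?_
    rw [expMeasure_Ioi le_rfl]
    simp
  by_cases hc : c = ∞
  · subst hc
    rw [lintegral_congr_ae (g := fun _ => 0)]
    · simp
    · filter_upwards [hpos] with x hx
      rw [ENNReal.top_mul (by simpa using hx), expNeg_top]
  lift c to ℝ≥0 using hc
  have h1 : ∫⁻ x, exponentialPDF (1 + c) x = 1 := lintegral_exponentialPDF_eq_one (by positivity)
  have h2 : ∀ x, exponentialPDF (1 + c) x =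
      ENNReal.ofReal (1 + c) * (exponentialPDF 1 x * expNeg (c * ENNReal.ofReal x)) := by
    intro x
    rcases lt_or_ge x 0 with hx | hx
    · rw [exponentialPDF_of_neg hx, exponentialPDF_of_neg hx]
      simp
    · rw [exponentialPDF_of_nonneg hx, exponentialPDF_of_nonneg hx, ← ENNReal.ofReal_coe_nnreal,
        ← ENNReal.ofReal_mul (by positivity), expNeg_ofReal (by positivity),
        ← ENNReal.ofReal_mul (by positivity), ← ENNReal.ofReal_mul (by positivity)]
      congr 1
      rw [one_mul, one_mul, ← Real.exp_add]
      ring_nf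
  have hm : Measurable (exponentialPDF 1) := (measurable_exponentialPDFReal 1).ennreal_ofReal
  have hm2 : Measurable fun x : ℝ => expNeg (c * ENNReal.ofReal x) :=
    measurable_expNeg.comp (by fun_prop)
  have h3 : ∫⁻ x, expNeg (c * ENNReal.ofReal x) ∂(expMeasure 1)
      = ∫⁻ x, exponentialPDF 1 x * expNeg (c * ENNReal.ofReal x) := by
    rw [expMeasure, gammaMeasure]
    exact lintegral_withDensity_eq_lintegral_mul _ hm hm2
  simp_rw [h2] at h1
  rw [lintegral_const_mul' _ _ ENNReal.ofReal_ne_top, ← h3] at h1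
  rw [ENNReal.eq_inv_of_mul_eq_one_left ((mul_comm _ _).trans h1)]
  congr 1
  rw [ENNReal.ofReal_add zero_le_one c.coe_nonneg]
  simp

variable {Ω : Type*} [MeasurableSpace Ω] {P : Measure Ω}

/-- An exponential variable exceeds an independent threshold `T` with probability `E[e^{-T}]`. -/
lemma measure_lt_ofReal_of_exp [IsProbabilityMeasure P] {h : Ω → ℝ} (hm : Measurable h) (hlaw : P.map h = expMeasure 1)
    {T : Ω → ℝ≥0∞} (hT : Measurable T) (hind : IndepFun T h P) :
    P {ω | T ω < ENNReal.ofReal (h ω)} = ∫⁻ ω, expNeg (T ω) ∂P := by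
  have h1 : ∀ t : ℝ≥0∞, P {ω | t < ENNReal.ofReal (h ω)} = expNeg t := by
    intro t
    by_cases ht : t = ∞
    · simp [ht]
    lift t to ℝ≥0 using ht
    have : {ω | (t : ℝ≥0∞) < ENNReal.ofReal (h ω)} = h ⁻¹' (Ioi (t : ℝ)) := by
      ext ω
      rw [mem_ofPred_eq, mem_preimage, mem_Ioi, ← ENNReal.ofReal_coe_nnreal,
        ENNReal.ofReal_lt_ofReal_iff']
      exact ⟨fun h => h.1, fun h => ⟨h, t.2.trans_lt h⟩⟩
    rw [this, ← Measure.map_apply hm measurableSet_Ioi, hlaw, expMeasure_Ioi t.coe_nonneg,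
      ← expNeg_ofReal t.coe_nonneg]
    simp
  have hF : Measurable (Function.uncurry fun (t : ℝ≥0∞) (x : ℝ) =>
      {z : ℝ≥0∞ × ℝ | z.1 < ENNReal.ofReal z.2}.indicator (1 : ℝ≥0∞ × ℝ → ℝ≥0∞) (t, x)) :=
    measurable_one.indicator (measurableSet_lt measurable_fst measurable_snd.ennreal_ofReal)
  have h2 := lintegral_of_indepFun hT hm hind hF
  have hms : MeasurableSet {ω | T ω < ENNReal.ofReal (h ω)} := measurableSet_lt hT hm.ennreal_ofReal
  rw [← lintegral_indicator_one hms]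
  refine h2.trans (lintegral_congr fun ω => ?_)
  rw [← h1, ← lintegral_indicator_one (measurableSet_lt measurable_const hm.ennreal_ofReal)]
  rfl

lemma lintegral_expNeg_mul_of_exp {h : Ω → ℝ} (hm : Measurable h)
    (hlaw : P.map h = expMeasure 1) (c : ℝ≥0∞) :
    ∫⁻ ω, expNeg (c * ENNReal.ofReal (h ω)) ∂P = (1 + c)⁻¹ := by
  rw [← lintegral_expNeg_mul_expMeasure, ← hlaw, lintegral_map _ hm]
  exact measurable_expNeg.comp (by fun_prop)

/-- The Laplace transform of the squared distance to the nearest point of a Poisson process. -/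
lemma IsPoissonProcess.lintegral_nearDist_sq [IsProbabilityMeasure P] {Y : ℕ → Ω → Plane} {lam : ℝ}
    (hY : IsPoissonProcess P Y lam) (hlam : 0 < lam) {c : ℝ} (hc : 0 ≤ c) :
    ∫⁻ ω, expNeg (ENNReal.ofReal (c * nearDist Y ω ^ 2)) ∂P =
      ENNReal.ofReal (1 / (c / (Real.pi * lam) + 1)) := by
  have hm : Measurable fun ω => Real.pi * lam * nearDist Y ω ^ 2 :=
    ((measurable_nearDist hY.measurable).pow_const 2).const_mul _
  have hpl : 0 < Real.pi * lam := by positivity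
  -- The void probability of the disc of radius `a` is `e^{-πλa²}`, so `πλR²` has the Exp(1) tail;
  -- closed half-lines are used because void events have the form `a ≤ R`.
  have hlaw : P.map (fun ω => Real.pi * lam * nearDist Y ω ^ 2) = expMeasure 1 := by
    have : IsProbabilityMeasure (expMeasure 1) := isProbabilityMeasure_expMeasure one_pos
    have := Measure.isProbabilityMeasure_map hm.aemeasurable (μ := P)
    refine Measure.ext_of_Ici _ _ fun t => ?_
    rw [Measure.map_apply hm measurableSet_Ici]
    rcases le_or_gt t 0 with ht | ht
    · have h1 : (fun ω => Real.pi * lam * nearDist Y ω ^ 2) ⁻¹' Ici t = univ := by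
        ext ω
        simp only [mem_preimage, mem_Ici, mem_univ, iff_true]
        exact ht.trans (by positivity)
      rw [h1, measure_univ]
      refine le_antisymm ?_ prob_le_one
      calc (1 : ℝ≥0∞) = expMeasure 1 (Ici 0) := by rw [expMeasure_Ici le_rfl]; simp
        _ ≤ _ := measure_mono (Ici_subset_Ici.2 ht)
    · have h1 : (fun ω => Real.pi * lam * nearDist Y ω ^ 2) ⁻¹' Ici t =
          {ω | √(t / (Real.pi * lam)) ≤ nearDist Y ω} := by
        ext ω
        rw [mem_preimage, mem_Ici, mem_ofPred_eq, Real.sqrt_le_left (nearDist_nonneg _ _),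
          div_le_iff₀ hpl, mul_comm]
      rw [h1, hY.measure_le_nearDist hlam.le, expMeasure_Ici ht.le,
        EuclideanSpace.volume_ball_fin_two, ← expNeg_ofReal ht.le,
        ← ENNReal.ofReal_pow (Real.sqrt_nonneg _), Real.sq_sqrt (by positivity),
        ← ENNReal.ofReal_mul (by positivity), ← ENNReal.ofReal_mul hlam.le]
      congr 2
      field_simp
  have h1 := lintegral_expNeg_mul_of_exp hm hlaw (ENNReal.ofReal (c / (Real.pi * lam)))
  rw [one_div, ENNReal.ofReal_inv_of_pos (by positivity), ENNReal.ofReal_add (by positivity) zero_le_one,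
    add_comm, ENNReal.ofReal_one, ← h1]
  refine lintegral_congr fun ω => ?_
  rw [← ENNReal.ofReal_mul (by positivity)]
  congr 2
  field_simp

end Exponential

/-! ### The Gaussian link length. -/

section Gaussian

lemma integral_exp_neg_mul_sq_gaussianReal {c : ℝ} (hc : 0 ≤ c) :
    ∫ x, Real.exp (-(c * x ^ 2)) ∂(gaussianReal 0 1) = √(1 / (1 + 2 * c)) := by
  rw [integral_gaussianReal_eq_integral_smul one_ne_zero]
  have h1 : ∀ x : ℝ, gaussianPDFReal 0 1 x • Real.exp (-(c * x ^ 2)) =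
      (√(2 * Real.pi))⁻¹ * Real.exp (-(c + 1 / 2) * x ^ 2) := by
    intro x
    rw [gaussianPDFReal, smul_eq_mul, mul_assoc, ← Real.exp_add]
    simp only [NNReal.coe_one, mul_one, sub_zero]
    congr 2
    ring
  simp_rw [h1]
  rw [integral_const_mul, integral_gaussian, ← Real.sqrt_inv, ← Real.sqrt_mul (by positivity)]
  congr 1
  have := Real.pi_pos
  field_simp
  ring

/-- The integrand factors over two independent coordinates, each contributing `(1 + 2c)^{-1/2}`;
dimension two removes the square root. -/
lemma lintegral_expNeg_normSq_stdGaussian {c : ℝ} (hc : 0 ≤ c) :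
    ∫⁻ x, expNeg (ENNReal.ofReal (c * ‖x‖ ^ 2)) ∂(stdGaussian Plane) =
      ENNReal.ofReal (1 / (1 + 2 * c)) := by
  have hcont : Continuous fun x : Plane => Real.exp (-(c * ‖x‖ ^ 2)) := by fun_prop
  simp_rw [fun x : Plane => expNeg_ofReal (t := c * ‖x‖ ^ 2) (by positivity)]
  rw [← ofReal_integral_eq_lintegral_ofReal ?_ (Eventually.of_forall fun x => by positivity)]
  · rw [← map_pi_eq_stdGaussian, integral_map (by fun_prop) hcont.aestronglyMeasurable]
    have h1 : ∀ x : Fin 2 → ℝ, Real.exp (-(c * ‖(WithLp.toLp 2 x : Plane)‖ ^ 2)) =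
        ∏ i, Real.exp (-(c * x i ^ 2)) := by
      intro x
      rw [← Real.exp_sum, EuclideanSpace.real_norm_sq_eq]
      simp [mul_add, add_comm]
    simp_rw [h1]
    rw [integral_fintype_prod_eq_prod (fun _ (x : ℝ) => Real.exp (-(c * x ^ 2)))]
    simp only [integral_exp_neg_mul_sq_gaussianReal hc, Finset.prod_const, Finset.card_univ, Fintype.card_fin]
    rw [Real.sq_sqrt (by positivity)]
  · refine Integrable.of_bound hcont.aestronglyMeasurable 1 (Eventually.of_forall fun x => ?_)
    rw [Real.norm_of_nonneg (by positivity), Real.exp_le_one_iff, Left.neg_nonpos_iff]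
    positivity

end Gaussian

/-! ### Polar coordinates for nonnegative functions. -/

section Polar

lemma lintegral_fun_norm_plane {f : ℝ → ℝ≥0∞} (hf : Measurable f) :
    ∫⁻ x : Plane, f ‖x‖ =
      ENNReal.ofReal (2 * Real.pi) * ∫⁻ r in Ioi (0 : ℝ), ENNReal.ofReal r * f r := by
  have hdim : Module.finrank ℝ Plane - 1 = 1 := by simp
  calc ∫⁻ x : Plane, f ‖x‖
      = ∫⁻ x : ({(0)}ᶜ : Set Plane), f ‖x.1‖ ∂(Measure.comap Subtype.val volume) := by
        rw [lintegral_subtype_comap (measurableSet_singleton _).compl fun x : Plane => f (‖x‖),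
          restrict_compl_singleton]
    _ = ∫⁻ x : Metric.sphere (0 : Plane) 1 × Ioi (0 : ℝ), f x.2
          ∂((volume : Measure Plane).toSphere.prod (Measure.volumeIoiPow (Module.finrank ℝ Plane - 1))) := by
        simpa using (volume : Measure Plane).measurePreserving_homeomorphUnitSphereProd.lintegral_comp_emb
          (Homeomorph.measurableEmbedding _) (f ∘ Subtype.val ∘ Prod.snd)
    _ = (volume : Measure Plane).toSphere univ * ∫⁻ x : Ioi (0 : ℝ), f x.1 ∂Measure.volumeIoiPow 1 := by
        rw [hdim, lintegral_prod _ (by fun_prop)]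
        simp [mul_comm]
    _ = _ := by
        rw [Measure.toSphere_apply_univ, Measure.volumeIoiPow,
          lintegral_withDensity_eq_lintegral_mul _ (by fun_prop) (by fun_prop)]
        have := lintegral_subtype_comap (μ := (volume : Measure ℝ)) (measurableSet_Ioi (a := (0 : ℝ)))
          fun r : ℝ => ENNReal.ofReal (r ^ 1) * f r
        simp only [Pi.mul_apply]
        refine (congrArg _ this).trans ?_
        simp [ENNReal.ofReal_mul]

end Polar

/-! ### The radial integrals behind κ, `H₀` and `H₁`. -/

section Integrals

lemma lintegral_rpow_mul_exp {a r : ℝ} (ha : 0 < a) (hr : 0 < r) :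
    ∫⁻ t in Ioi (0 : ℝ), ENNReal.ofReal (t ^ (a - 1) * Real.exp (-(r * t))) =
      ENNReal.ofReal ((1 / r) ^ a * Real.Gamma a) := by
  have h := Real.integral_rpow_mul_exp_neg_mul_Ioi ha hr
  have hpos : 0 < (1 / r) ^ a * Real.Gamma a := by
    have := Real.Gamma_pos_of_pos ha
    positivity
  rw [← h, ofReal_integral_eq_lintegral_ofReal]
  -- A Bochner integral with nonzero value forces integrability.
  · exact Integrable.of_integral_ne_zero (by rw [h]; exact hpos.ne')
  · filter_upwards [ae_restrict_mem measurableSet_Ioi] with t ht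
    have : (0 : ℝ) < t := ht
    positivity

/-- Write `1/(1 + t)` as `∫ e^{-(1+t)u} du` and exchange the integrals by Tonelli: the result is
`Γ(a) Γ(1 - a)`, to which the reflection formula applies. The computation in `[0, ∞]` also yields
integrability. -/
lemma integral_rpow_div_one_add {a : ℝ} (ha : 0 < a) (ha1 : a < 1) :
    IntegrableOn (fun t : ℝ => t ^ (a - 1) / (1 + t)) (Ioi 0) ∧
      ∫ t in Ioi (0 : ℝ), t ^ (a - 1) / (1 + t) = Real.pi / Real.sin (Real.pi * a) := by
  have hG := Real.Gamma_pos_of_pos ha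
  have hG' := Real.Gamma_pos_of_pos (sub_pos.2 ha1)
  have hnn : ∀ᵐ t ∂(volume.restrict (Ioi (0 : ℝ))), 0 ≤ t ^ (a - 1) / (1 + t) := by
    filter_upwards [ae_restrict_mem measurableSet_Ioi] with t ht
    have : (0 : ℝ) < t := ht
    positivity
  have hmeas : Measurable fun t : ℝ => t ^ (a - 1) / (1 + t) := by fun_prop
  have key : ∫⁻ t in Ioi (0 : ℝ), ENNReal.ofReal (t ^ (a - 1) / (1 + t)) =
      ENNReal.ofReal (Real.Gamma a * Real.Gamma (1 - a)) := by
    calc ∫⁻ t in Ioi (0 : ℝ), ENNReal.ofReal (t ^ (a - 1) / (1 + t))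
        = ∫⁻ t in Ioi (0 : ℝ), ∫⁻ u in Ioi (0 : ℝ),
            ENNReal.ofReal (t ^ (a - 1) * Real.exp (-((1 + t) * u))) := by
          refine setLIntegral_congr_fun measurableSet_Ioi fun t ht => ?_
          have ht' : (0 : ℝ) < t := ht
          have h1 := lintegral_rpow_mul_exp one_pos (show 0 < 1 + t by positivity)
          simp only [sub_self, Real.rpow_zero, one_mul, Real.rpow_one, Real.Gamma_one,
            mul_one] at h1
          simp_rw [fun u : ℝ => ENNReal.ofReal_mul (q := Real.exp (-((1 + t) * u)))
            (Real.rpow_nonneg ht'.le (a - 1))]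
          rw [lintegral_const_mul' _ _ ENNReal.ofReal_ne_top, h1, ← ENNReal.ofReal_mul (by positivity),
            mul_one_div]
      _ = ∫⁻ u in Ioi (0 : ℝ), ∫⁻ t in Ioi (0 : ℝ),
            ENNReal.ofReal (t ^ (a - 1) * Real.exp (-((1 + t) * u))) := by
          refine lintegral_lintegral_swap (Measurable.aemeasurable ?_)
          unfold Function.uncurry
          fun_prop
      _ = ∫⁻ u in Ioi (0 : ℝ), ENNReal.ofReal (Real.Gamma a) *
            ENNReal.ofReal (u ^ (1 - a - 1) * Real.exp (-(1 * u))) := by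
          refine setLIntegral_congr_fun measurableSet_Ioi fun u hu => ?_
          have hu' : (0 : ℝ) < u := hu
          have h1 : ∀ t : ℝ, t ^ (a - 1) * Real.exp (-((1 + t) * u)) =
              Real.exp (-(1 * u)) * (t ^ (a - 1) * Real.exp (-(u * t))) := by
            intro t
            rw [mul_left_comm, ← Real.exp_add]
            ring_nf
          simp_rw [h1, fun t : ℝ => ENNReal.ofReal_mul (q := t ^ (a - 1) * Real.exp (-(u * t)))
            (Real.exp_pos (-(1 * u))).le]
          rw [lintegral_const_mul' _ _ ENNReal.ofReal_ne_top, lintegral_rpow_mul_exp ha hu',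
            ← ENNReal.ofReal_mul (by positivity), ← ENNReal.ofReal_mul hG.le]
          congr 1
          rw [one_div, Real.inv_rpow hu'.le, ← Real.rpow_neg hu'.le, show 1 - a - 1 = -a by ring]
          ring
      _ = _ := by
          rw [lintegral_const_mul' _ _ ENNReal.ofReal_ne_top,
            lintegral_rpow_mul_exp (sub_pos.2 ha1) one_pos, ← ENNReal.ofReal_mul hG.le]
          simp
  refine ⟨⟨hmeas.aestronglyMeasurable, ?_⟩, ?_⟩
  · rw [hasFiniteIntegral_iff_ofReal hnn, key]
    exact ENNReal.ofReal_lt_top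
  · rw [integral_eq_lintegral_of_nonneg_ae hnn hmeas.aestronglyMeasurable, key,
      ENNReal.toReal_ofReal (by positivity), Real.Gamma_mul_Gamma_one_sub]

/-- `x / (1 + K⁻¹ x^α)`. -/
noncomputable def lossKernel (α K x : ℝ) : ℝ := x / (1 + K⁻¹ * x ^ α)

lemma lossKernel_nonneg {α K x : ℝ} (hK : 0 < K) (hx : 0 ≤ x) : 0 ≤ lossKernel α K x := by
  unfold lossKernel; positivity

/-- The substitution `t = x^α` reduces this to the Beta integral with `a = 2/α`; `α > 2` is what
puts `a` below 1. -/
lemma integral_lossKernel_one {α : ℝ} (hα : 2 < α) :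
    IntegrableOn (lossKernel α 1) (Ioi 0) ∧
      ∫ x in Ioi (0 : ℝ), lossKernel α 1 x = (2 * Real.pi / α) / Real.sin (2 * Real.pi / α) / 2 := by
  have hα0 : 0 < α := by linarith
  obtain ⟨h1, h2⟩ := integral_rpow_div_one_add (a := 2 / α) (by positivity)
    ((div_lt_one hα0).2 hα)
  have hcongr : ∀ x ∈ Ioi (0 : ℝ), (|α| * x ^ (α - 1)) •
      ((1 / α) * ((x ^ α) ^ (2 / α - 1) / (1 + x ^ α))) = lossKernel α 1 x := by
    intro x hx
    have hx' : (0 : ℝ) < x := hx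
    rw [abs_of_pos hα0, ← Real.rpow_mul hx'.le, smul_eq_mul, lossKernel]
    have h3 : x ^ (α - 1) * x ^ (α * (2 / α - 1)) = x := by
      rw [← Real.rpow_add hx']
      have : α - 1 + α * (2 / α - 1) = 1 := by field_simp; ring
      rw [this, Real.rpow_one]
    calc α * x ^ (α - 1) * (1 / α * (x ^ (α * (2 / α - 1)) / (1 + x ^ α)))
        = (x ^ (α - 1) * x ^ (α * (2 / α - 1))) / (1 + x ^ α) := by field_simp
      _ = _ := by rw [h3]; simp
  constructor
  · have h4 := (integrableOn_Ioi_comp_rpow_iff (fun t : ℝ => (1 / α) * (t ^ (2 / α - 1) / (1 + t)))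
      hα0.ne').2 (h1.const_mul (1 / α))
    exact h4.congr_fun hcongr measurableSet_Ioi
  · rw [← setIntegral_congr_fun measurableSet_Ioi hcongr,
      integral_comp_rpow_Ioi (fun t : ℝ => (1 / α) * (t ^ (2 / α - 1) / (1 + t))) hα0.ne',
      integral_const_mul, h2]
    field_simp

lemma lossKernel_eq_scale {α K x : ℝ} (hα : 0 < α) (hK : 0 < K) (hx : 0 < x) :
    lossKernel α K x = K ^ α⁻¹ * lossKernel α 1 ((K ^ α⁻¹)⁻¹ * x) := by
  have hK' : 0 < K ^ α⁻¹ := by positivity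
  rw [lossKernel, lossKernel, Real.mul_rpow (by positivity) hx.le, Real.inv_rpow hK'.le,
    ← Real.rpow_mul hK.le, inv_mul_cancel₀ hα.ne', Real.rpow_one, inv_one, one_mul, ← mul_div_assoc,
    mul_inv_cancel_left₀ hK'.ne']

/-- Rescaling `x` by `K^{1/α}` reduces to `K = 1`; the kernel and `dx` each contribute one factor
`K^{1/α}`. -/
lemma integral_lossKernel {α K : ℝ} (hα : 2 < α) (hK : 0 < K) :
    IntegrableOn (lossKernel α K) (Ioi 0) ∧
      ∫ x in Ioi (0 : ℝ), lossKernel α K x =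
        K ^ (2 / α) * ((2 * Real.pi / α) / Real.sin (2 * Real.pi / α)) / 2 := by
  have hα0 : 0 < α := by linarith
  have hK' : 0 < K ^ α⁻¹ := by positivity
  obtain ⟨h1, h2⟩ := integral_lossKernel_one hα
  have hcongr : ∀ x ∈ Ioi (0 : ℝ), K ^ α⁻¹ * lossKernel α 1 ((K ^ α⁻¹)⁻¹ * x) = lossKernel α K x :=
    fun x hx => (lossKernel_eq_scale hα0 hK hx).symm
  constructor
  · have h3 := (integrableOn_Ioi_comp_mul_left_iff (lossKernel α 1) 0 (inv_pos.2 hK')).2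
      (by rwa [mul_zero])
    exact IntegrableOn.congr_fun (h3.const_mul (K ^ α⁻¹)) hcongr measurableSet_Ioi
  · rw [← setIntegral_congr_fun measurableSet_Ioi hcongr, integral_const_mul,
      integral_comp_mul_left_Ioi (lossKernel α 1) 0 (inv_pos.2 hK'), mul_zero, h2, inv_inv,
      smul_eq_mul]
    have : K ^ (2 / α) = K ^ α⁻¹ * K ^ α⁻¹ := by
      rw [← Real.rpow_add hK]; congr 1; ring
    rw [this]
    ring

/-- The mean loss, in polar coordinates, outside a disc of radius `a r`. -/
lemma lintegral_loss {α K r a : ℝ} (hα : 2 < α) (hK : 0 < K) (hr : 0 < r) (ha : 0 ≤ a) :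
    ∫⁻ x : Plane, {x : Plane | a * r < ‖x‖}.indicator
        (fun x => ENNReal.ofReal (1 / (1 + K⁻¹ * (r⁻¹ * ‖x‖) ^ α))) x =
      ENNReal.ofReal (2 * Real.pi * r ^ 2 * ∫ x in Ioi a, lossKernel α K x) := by
  have hα0 : 0 < α := by linarith
  have hmeas : Measurable fun t : ℝ => ENNReal.ofReal (1 / (1 + K⁻¹ * (r⁻¹ * t) ^ α)) := by fun_prop
  have har : 0 ≤ a * r := by positivity
  have hsub : Ioi (a * r) ⊆ Ioi (0 : ℝ) := Ioi_subset_Ioi har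
  have h1 := lintegral_fun_norm_plane (hmeas.indicator (measurableSet_Ioi (a := a * r)))
  refine h1.trans ?_
  have h2 : ∫⁻ t in Ioi (0 : ℝ), ENNReal.ofReal t * (Ioi (a * r)).indicator
      (fun t : ℝ => ENNReal.ofReal (1 / (1 + K⁻¹ * (r⁻¹ * t) ^ α))) t =
      ∫⁻ t in Ioi (a * r), ENNReal.ofReal (r * lossKernel α K (r⁻¹ * t)) := by
    simp_rw [← indicator_mul_right]
    rw [setLIntegral_indicator measurableSet_Ioi, inter_eq_self_of_subset_left hsub]
    refine setLIntegral_congr_fun measurableSet_Ioi fun t ht => ?_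
    have ht' : 0 < t := hsub ht
    rw [← ENNReal.ofReal_mul ht'.le, lossKernel]
    congr 1
    field_simp
  have h3 : ∫ t in Ioi (a * r), r * lossKernel α K (r⁻¹ * t) =
      r ^ 2 * ∫ x in Ioi a, lossKernel α K x := by
    rw [integral_const_mul, integral_comp_mul_left_Ioi _ _ (inv_pos.2 hr), inv_inv, smul_eq_mul]
    have : r⁻¹ * (a * r) = a := by field_simp
    rw [this]
    ring
  have h4 : IntegrableOn (fun t => r * lossKernel α K (r⁻¹ * t)) (Ioi (a * r)) := by
    refine Integrable.const_mul ?_ r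
    refine (integrableOn_Ioi_comp_mul_left_iff _ _ (inv_pos.2 hr)).2 ?_
    exact (integral_lossKernel hα hK).1.mono_set (Ioi_subset_Ioi (by positivity))
  rw [h2, ← ofReal_integral_eq_lintegral_ofReal h4, h3, ← ENNReal.ofReal_mul (by positivity)]
  · congr 1
    ring
  · filter_upwards [ae_restrict_mem measurableSet_Ioi] with t ht
    have : 0 < t := hsub ht
    exact mul_nonneg hr.le (lossKernel_nonneg hK (by positivity))

end Integrals

/-! ### Interference from a marked Poisson process. -/

section Marks

lemma measurable_rxPower (α Q : ℝ) : Measurable fun z : ℝ × Plane => rxPower α Q z.1 z.2 := by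
  unfold rxPower; fun_prop

/-- Power received at the origin from the transmitters at `x n` with fading `m n`, over those `n`
that are switched on. -/
noncomputable def interf (α Q : ℝ) (x : ℕ → Plane) (m : ℕ → Bool × ℝ) : ℝ≥0∞ :=
  ∑' n, if (m n).1 = true then rxPower α Q (m n).2 (x n) else 0

lemma measurable_interf (α Q : ℝ) : Measurable (Function.uncurry (interf α Q)) := by
  refine Measurable.tsum fun n => Measurable.ite ?_ ?_ measurable_const
  · exact (measurable_fst.comp ((measurable_pi_apply n).comp measurable_snd))
      (measurableSet_singleton true)
  · exact (measurable_rxPower α Q).comp ((measurable_snd.comp ((measurable_pi_apply n).comp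
      measurable_snd)).prodMk ((measurable_pi_apply n).comp measurable_fst))

/-- The mean of `e^{-s Z}`, where `Z` is the power received from a transmitter at `y` that is on
with probability `q`. -/
noncomputable def markLaplace (α Q q : ℝ) (s : ℝ≥0∞) (y : Plane) : ℝ≥0∞ :=
  1 - ENNReal.ofReal q * (1 - (1 + s * (ENNReal.ofReal Q * ‖y‖ₑ ^ (-α)))⁻¹)

lemma markLaplace_le_one (α Q q : ℝ) (s : ℝ≥0∞) (y : Plane) : markLaplace α Q q s y ≤ 1 :=
  tsub_le_self

lemma measurable_markLaplace (α Q q : ℝ) (s : ℝ≥0∞) : Measurable (markLaplace α Q q s) := by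
  unfold markLaplace; fun_prop

variable {Ω : Type*} [MeasurableSpace Ω] {P : Measure Ω}

lemma lintegral_expNeg_mark [IsProbabilityMeasure P] {α Q q : ℝ} {on : Ω → Bool} {h : Ω → ℝ}
    (hon : Measurable on) (hh : Measurable h) (honlaw : P {ω | on ω = true} = ENNReal.ofReal q)
    (hlaw : P.map h = expMeasure 1) (hind : IndepFun on h P) (s : ℝ≥0∞) (y : Plane) :
    ∫⁻ ω, expNeg (s * if on ω = true then rxPower α Q (h ω) y else 0) ∂P =
      markLaplace α Q q s y := by
  set w := s * (ENNReal.ofReal Q * ‖y‖ₑ ^ (-α)) with hw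
  -- The integrand is `1 - a * b`, with `a` the on-indicator and `b = 1 - e^{-w h}`, so independence
  -- of flag and gain can be applied to a product.
  let a : Bool → ℝ≥0∞ := fun b => if b = true then 1 else 0
  let b : ℝ → ℝ≥0∞ := fun x => 1 - expNeg (w * ENNReal.ofReal x)
  have ha : Measurable a := measurable_of_countable _
  have he : Measurable fun x : ℝ => expNeg (w * ENNReal.ofReal x) :=
    measurable_expNeg.comp (by fun_prop)
  have hb : Measurable b := measurable_const.sub he
  have h1 : ∀ ω, expNeg (s * if on ω = true then rxPower α Q (h ω) y else 0) =
      1 - a (on ω) * b (h ω) := by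
    intro ω
    by_cases hω : on ω = true
    · have : s * rxPower α Q (h ω) y = w * ENNReal.ofReal (h ω) := by
        rw [rxPower, hw]; ring
      simp only [hω, if_true, a, b, one_mul, this]
      rw [ENNReal.sub_sub_cancel ENNReal.one_ne_top (expNeg_le_one _)]
    · simp [hω, a]
  have hle : ∀ ω, a (on ω) * b (h ω) ≤ 1 := by
    intro ω
    refine mul_le_one' ?_ tsub_le_self
    simp only [a]
    split_ifs <;> simp
  have h2 : ∫⁻ ω, a (on ω) * b (h ω) ∂P = ENNReal.ofReal q * (1 - (1 + w)⁻¹) := by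
    have h3 := lintegral_mul_eq_lintegral_mul_lintegral_of_indepFun (ha.comp hon) (hb.comp hh)
      (hind.comp ha hb)
    refine h3.trans ?_
    congr 1
    · rw [← honlaw, ← lintegral_indicator_one (s := {ω | on ω = true})
        (hon (measurableSet_singleton true))]
      refine lintegral_congr fun ω => ?_
      by_cases hω : on ω = true <;> simp [hω, a, indicator]
    · rw [← lintegral_expNeg_mul_of_exp hh hlaw w]
      simp only [Function.comp_def, b]
      rw [lintegral_sub (f := fun _ => 1) (g := fun ω => expNeg (w * ENNReal.ofReal (h ω)))
        (he.comp hh) ((lintegral_expNeg_le_one _).trans_lt ENNReal.one_lt_top).ne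
        (Eventually.of_forall fun _ => expNeg_le_one _)]
      simp
  simp_rw [h1]
  rw [lintegral_sub (f := fun _ => 1) (g := fun ω => a (on ω) * b (h ω))
    ((ha.comp hon).mul (hb.comp hh)) ?_ (Eventually.of_forall hle), h2, markLaplace, ← hw]
  · simp
  · exact ne_top_of_le_ne_top ENNReal.one_ne_top ((lintegral_mono hle).trans (by simp))

/-- A family of transmitters with independent marks: on with probability `q`, Rayleigh fading. -/
structure IsMarked (P : Measure Ω) (on : ℕ → Ω → Bool) (h : ℕ → Ω → ℝ) (q : ℝ) : Prop where
  on_measurable : ∀ n, Measurable (on n)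
  on_law : ∀ n, P {ω | on n ω = true} = ENNReal.ofReal q
  h_measurable : ∀ n, Measurable (h n)
  h_law : ∀ n, P.map (h n) = expMeasure 1
  indep_pair : ∀ n, IndepFun (on n) (h n) P
  indep : iIndepFun (fun n ω => (on n ω, h n ω)) P

variable {on : ℕ → Ω → Bool} {h : ℕ → Ω → ℝ} {q : ℝ}

lemma IsMarked.measurable (hm : IsMarked P on h q) :
    Measurable fun ω n => (on n ω, h n ω) :=
  measurable_pi_iff.2 fun n => (hm.on_measurable n).prodMk (hm.h_measurable n)

/-- The Laplace transform of the interference from transmitters at given locations. -/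
lemma IsMarked.lintegral_fixed [IsProbabilityMeasure P] (hm : IsMarked P on h q) (α Q : ℝ) (s : ℝ≥0∞) (S : Set ℕ)
    [DecidablePred (· ∈ S)] (x : ℕ → Plane) :
    ∫⁻ ω, expNeg (s * ∑' n, if on n ω = true ∧ n ∈ S then rxPower α Q (h n ω) (x n) else 0) ∂P =
      expNeg (∑' n, if n ∈ S then negLog (markLaplace α Q q s (x n)) else 0) := by
  have hF : ∀ n, Measurable fun z : Bool × ℝ =>
      s * if z.1 = true ∧ n ∈ S then rxPower α Q z.2 (x n) else 0 := fun n => by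
    refine Measurable.const_mul (Measurable.ite ?_ ?_ measurable_const) s
    · have h1 : {z : Bool × ℝ | z.1 = true ∧ n ∈ S} = {z | z.1 = true} ∩ {z | n ∈ S} := rfl
      rw [h1]
      exact (measurable_fst (measurableSet_singleton true)).inter (MeasurableSet.const _)
    · exact (measurable_rxPower α Q).comp (measurable_snd.prodMk measurable_const)
  simp_rw [← ENNReal.tsum_mul_left]
  have h1 := lintegral_expNeg_tsum (P := P) (Z := fun n ω =>
    s * if on n ω = true ∧ n ∈ S then rxPower α Q (h n ω) (x n) else 0)
    (fun n => (hF n).comp ((hm.on_measurable n).prodMk (hm.h_measurable n)))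
    (hm.indep.comp (fun n (z : Bool × ℝ) =>
      s * if z.1 = true ∧ n ∈ S then rxPower α Q z.2 (x n) else 0) hF)
  rw [h1]
  congr 1
  refine tsum_congr fun n => ?_
  by_cases hn : n ∈ S
  · simp only [hn, and_true, if_true]
    rw [lintegral_expNeg_mark (hm.on_measurable n) (hm.h_measurable n) (hm.on_law n) (hm.h_law n)
      (hm.indep_pair n)]
  · simp [hn, negLog]

/-- The Laplace transform of the interference from a marked Poisson process. -/
lemma IsMarked.lintegral_interf [IsProbabilityMeasure P] (hm : IsMarked P on h q) {X : ℕ → Ω → Plane} {lam : ℝ}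
    (hX : IsPoissonProcess P X lam) (hlam : 0 ≤ lam)
    (hind : IndepFun (fun ω n => X n ω) (fun ω n => (on n ω, h n ω)) P) (α Q : ℝ) (s : ℝ≥0∞) :
    ∫⁻ ω, expNeg (s * interf α Q (fun n => X n ω) (fun n => (on n ω, h n ω))) ∂P =
      expNeg (ENNReal.ofReal lam * lossIntegral fun y => negLog (markLaplace α Q q s y)) := by
  have hF : Measurable (Function.uncurry fun (x : ℕ → Plane) (m : ℕ → Bool × ℝ) =>
      expNeg (s * interf α Q x m)) :=
    measurable_expNeg.comp ((measurable_interf α Q).const_mul s)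
  -- Averaging the marks at frozen locations leaves `expNeg` of a sum over the points, to which the
  -- Laplace functional applies.
  rw [lintegral_of_indepFun (measurable_pi_iff.2 hX.measurable) hm.measurable hind hF,
    ← hX.laplace (f := fun y => negLog (markLaplace α Q q s y)) hlam
      (measurable_negLog.comp (measurable_markLaplace α Q q s))]
  refine lintegral_congr fun ω => ?_
  have := hm.lintegral_fixed α Q s univ (fun n => X n ω)
  simpa [interf] using this

/-- The factor by which noise and interference are multiplied in the SINR condition. -/
noncomputable def threshold (α β Q r : ℝ) : ℝ≥0∞ := ENNReal.ofReal (β / Q) * ENNReal.ofReal r ^ α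

lemma threshold_ne_top {α β Q r : ℝ} (hα : 0 ≤ α) : threshold α β Q r ≠ ∞ :=
  ENNReal.mul_ne_top ENNReal.ofReal_ne_top (ENNReal.rpow_ne_top_of_nonneg hα ENNReal.ofReal_ne_top)

lemma continuous_threshold {α β Q : ℝ} : Continuous (threshold α β Q) :=
  ENNReal.continuous_const_mul ENNReal.ofReal_ne_top |>.comp
    ((ENNReal.continuous_rpow_const).comp ENNReal.continuous_ofReal)

lemma monotone_threshold {α β Q : ℝ} (hα : 0 ≤ α) : Monotone (threshold α β Q) := fun _ _ h =>
  mul_le_mul_right (ENNReal.rpow_le_rpow (ENNReal.ofReal_le_ofReal h) hα) _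

lemma threshold_of_nonneg {α β Q r : ℝ} (hα : 0 ≤ α) (hβQ : 0 ≤ β / Q) (hr : 0 ≤ r) :
    threshold α β Q r = ENNReal.ofReal (β / Q * r ^ α) := by
  rw [threshold, ENNReal.ofReal_rpow_of_nonneg hr hα, ENNReal.ofReal_mul hβQ]

lemma enorm_rpow_neg {α : ℝ} {x : Plane} (hx : x ≠ 0) :
    ‖x‖ₑ ^ (-α) = ENNReal.ofReal (‖x‖ ^ (-α)) := by
  rw [← ofReal_norm, ENNReal.ofReal_rpow_of_pos (norm_pos_iff.2 hx)]

/-- The extreme values of `J` need no exclusion: for `J = 0` both sides hold, the quotient being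
`∞`, and for `J = ∞` both fail. -/
lemma lt_sinr_iff {α β Q f : ℝ} {x : Plane} (hα : 0 ≤ α) (hβ : 0 < β) (hQ : 0 < Q) (hf : 0 < f)
    (hx : x ≠ 0) (J : ℝ≥0∞) :
    ENNReal.ofReal β < rxPower α Q f x / J ↔ threshold α β Q ‖x‖ * J < ENNReal.ofReal f := by
  have hx' : 0 < ‖x‖ := norm_pos_iff.2 hx
  have hr : rxPower α Q f x = ENNReal.ofReal (Q * f * ‖x‖ ^ (-α)) := by
    rw [rxPower, enorm_rpow_neg hx, ← ENNReal.ofReal_mul hQ.le, ← ENNReal.ofReal_mul (by positivity)]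
  rw [hr, threshold_of_nonneg hα (by positivity) hx'.le]
  by_cases hJ : J = ∞
  · subst hJ
    rw [ENNReal.div_top, ENNReal.mul_top (by simp; positivity)]
    simp
  obtain ⟨j, hj, rfl⟩ : ∃ j : ℝ, 0 ≤ j ∧ J = ENNReal.ofReal j :=
    ⟨J.toReal, ENNReal.toReal_nonneg, (ENNReal.ofReal_toReal hJ).symm⟩
  rw [ENNReal.lt_div_iff_mul_lt (Or.inr ENNReal.ofReal_ne_top) (Or.inr (by simp; positivity)),
    ← ENNReal.ofReal_mul hβ.le, ← ENNReal.ofReal_mul (by positivity),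
    ENNReal.ofReal_lt_ofReal_iff (by positivity), ENNReal.ofReal_lt_ofReal_iff hf,
    Real.rpow_neg hx'.le, ← div_eq_mul_inv, lt_div_iff₀ (by positivity), ← mul_lt_mul_iff_right₀ (b := β / Q * ‖x‖ ^ α * j) hQ]
  have : Q * (β / Q * ‖x‖ ^ α * j) = β * j * ‖x‖ ^ α := by field_simp
  rw [this]

/-- The loss depends on `y` only through `‖y‖ / r`. This scale invariance is the source of the `r²`
in every exponent. -/
lemma one_sub_markLaplace {α β Q Q' q r : ℝ} (hα : 2 < α) (hβ : 0 < β) (hQ : 0 < Q) (hQ' : 0 < Q')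
    (hq : q ∈ Icc (0 : ℝ) 1) (hr : 0 < r) {y : Plane} (hy : y ≠ 0) :
    1 - markLaplace α Q' q (threshold α β Q r) y =
      ENNReal.ofReal q * ENNReal.ofReal (1 / (1 + (β * (Q' / Q))⁻¹ * (r⁻¹ * ‖y‖) ^ α)) := by
  have hy' : 0 < ‖y‖ := norm_pos_iff.2 hy
  have hw : threshold α β Q r * (ENNReal.ofReal Q' * ‖y‖ₑ ^ (-α)) =
      ENNReal.ofReal (β / Q * r ^ α * (Q' * ‖y‖ ^ (-α))) := by
    rw [threshold_of_nonneg (by linarith) (by positivity) hr.le, enorm_rpow_neg hy,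
      ← ENNReal.ofReal_mul hQ'.le, ← ENNReal.ofReal_mul (by positivity)]
  set w := β / Q * r ^ α * (Q' * ‖y‖ ^ (-α)) with hwdef
  have hw0 : 0 < w := by positivity
  have h1 : 1 - (1 + ENNReal.ofReal w)⁻¹ =
      ENNReal.ofReal (1 / (1 + (β * (Q' / Q))⁻¹ * (r⁻¹ * ‖y‖) ^ α)) := by
    rw [← ENNReal.ofReal_one, ← ENNReal.ofReal_add zero_le_one hw0.le,
      ← ENNReal.ofReal_inv_of_pos (by positivity), ← ENNReal.ofReal_sub _ (by positivity)]
    congr 1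
    have h2 : (β * (Q' / Q))⁻¹ * (r⁻¹ * ‖y‖) ^ α = w⁻¹ := by
      rw [hwdef, Real.mul_rpow (by positivity) hy'.le, Real.inv_rpow hr.le, Real.rpow_neg hy'.le]
      field_simp
    rw [h2]
    field_simp
    ring
  rw [markLaplace, hw, ENNReal.sub_sub_cancel ENNReal.one_ne_top, h1]
  refine mul_le_one' ?_ tsub_le_self
  simpa using hq.2

/-- The exponent in the Laplace transform of the interference from outside a disc of radius
`a r`. -/
lemma lossIntegral_markLaplace {α β Q Q' q r a : ℝ} (hα : 2 < α) (hβ : 0 < β) (hQ : 0 < Q)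
    (hQ' : 0 < Q') (hq : q ∈ Icc (0 : ℝ) 1) (hr : 0 < r) (ha : 0 ≤ a) :
    lossIntegral ({x : Plane | a * r < ‖x‖}.indicator
      fun y => negLog (markLaplace α Q' q (threshold α β Q r) y)) =
      ENNReal.ofReal (2 * Real.pi * q * r ^ 2 *
        ∫ x in Ioi a, lossKernel α (β * (Q' / Q)) x) := by
  have h1 : ∀ x, 1 - expNeg ({x : Plane | a * r < ‖x‖}.indicator
      (fun y => negLog (markLaplace α Q' q (threshold α β Q r) y)) x) =
      ENNReal.ofReal q * {x : Plane | a * r < ‖x‖}.indicator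
        (fun x => ENNReal.ofReal (1 / (1 + (β * (Q' / Q))⁻¹ * (r⁻¹ * ‖x‖) ^ α))) x := by
    intro x
    by_cases hx : a * r < ‖x‖
    · have hx0 : x ≠ 0 := norm_pos_iff.1 (lt_of_le_of_lt (by positivity) hx)
      rw [indicator_of_mem (by exact hx), indicator_of_mem (by exact hx),
        expNeg_negLog (markLaplace_le_one _ _ _ _ _), one_sub_markLaplace hα hβ hQ hQ' hq hr hx0]
    · rw [indicator_of_notMem (by exact hx), indicator_of_notMem (by exact hx)]
      simp
  rw [lossIntegral]
  simp_rw [h1]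
  rw [lintegral_const_mul' _ _ ENNReal.ofReal_ne_top, lintegral_loss hα (by positivity) hr ha,
    ← ENNReal.ofReal_mul hq.1]
  congr 1
  ring

/-- Brings the whole plane under `lossIntegral_markLaplace` with `a = 0`, only the origin being
lost. -/
lemma lossIntegral_congr_indicator_zero (f : Plane → ℝ≥0∞) (r : ℝ) :
    lossIntegral f = lossIntegral ({x : Plane | 0 * r < ‖x‖}.indicator f) := by
  refine lintegral_congr_ae ?_
  have h0 : ∀ᵐ x : Plane, x ≠ 0 := by simp [ae_iff]
  filter_upwards [h0] with x hx
  rw [indicator_of_mem (by simpa using hx)]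

end Marks

/-! ### Measurability relative to sets of labels. -/

lemma measurable_marks {Ω : Type*} {m : MeasurableSpace Ω} {on : ℕ → Ω → Bool} {h : ℕ → Ω → ℝ}
    (hon : ∀ n, Measurable[m] (on n)) (hh : ∀ n, Measurable[m] (h n)) :
    Measurable[m] fun ω n => (on n ω, h n ω) :=
  measurable_pi_iff.2 fun n => (hon n).prodMk (hh n)

lemma measurable_interf_comp {Ω : Type*} {m : MeasurableSpace Ω} {X : ℕ → Ω → Plane}
    {on : ℕ → Ω → Bool} {h : ℕ → Ω → ℝ} (hX : ∀ n, Measurable[m] (X n))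
    (hon : ∀ n, Measurable[m] (on n)) (hh : ∀ n, Measurable[m] (h n)) (α Q : ℝ) :
    Measurable[m] fun ω => interf α Q (fun n => X n ω) (fun n => (on n ω, h n ω)) :=
  (measurable_interf α Q).comp ((measurable_pi_iff.2 hX).prodMk (measurable_marks hon hh))

lemma ae_pos_of_exp {Ω : Type*} [MeasurableSpace Ω] {P : Measure Ω} {h : Ω → ℝ}
    (hm : Measurable h) (hlaw : P.map h = expMeasure 1) : ∀ᵐ ω ∂P, 0 < h ω := by
  have : IsProbabilityMeasure (expMeasure 1) := isProbabilityMeasure_expMeasure one_pos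
  refine ae_of_ae_map hm.aemeasurable ?_
  rw [hlaw]
  refine (mem_ae_iff_prob_eq_one measurableSet_Ioi).2 ?_
  rw [expMeasure_Ioi le_rfl]
  simp

namespace Elements

variable {M : ℕ} {Ω : Type*} (E : Elements M Ω)

/-- Whether a D2D transmitter is active and accesses the subband. -/
def onD (i : Fin M) (n : ℕ) (ω : Ω) : Bool := E.timeOn i n ω && E.freqOn i n ω

/-- Interference from the D2D transmitters of one type. -/
noncomputable def interfDType (p : Params M) (i : Fin M) (ω : Ω) : ℝ≥0∞ :=
  interf p.α p.PD (fun n => E.X i n ω) (fun n => (E.onD i n ω, E.h i n ω))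

lemma interfD_eq (p : Params M) (ω : Ω) : E.interfD p ω = ∑ i, E.interfDType p i ω := by
  simp [interfD, interfDType, interf, onD]

section Measurability

variable {E} {S : Set (Label M)}

/-- Recording which labels determine a quantity reduces each later independence claim to
disjointness of two label sets. -/
lemma measurable_of_mem {β : Type*} [MeasurableSpace β] {f : Ω → β} {l : Label M} (hl : l ∈ S)
    (hf : Measurable[E.sigma l] f) : Measurable[⨆ l ∈ S, E.sigma l] f :=
  hf.mono (le_biSup E.sigma hl) le_rfl

lemma measurable_X0 (hl : Label.linkLoc ∈ S) : Measurable[⨆ l ∈ S, E.sigma l] E.X0 :=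
  measurable_of_mem hl (comap_measurable _)

lemma measurable_h0 (hl : Label.linkFading ∈ S) : Measurable[⨆ l ∈ S, E.sigma l] E.h0 :=
  measurable_of_mem hl (comap_measurable _)

lemma measurable_X {i : Fin M} (hl : Label.d2dLoc i ∈ S) :
    Measurable[⨆ l ∈ S, E.sigma l] fun ω n => E.X i n ω :=
  measurable_of_mem hl (comap_measurable _)

lemma measurable_h {i : Fin M} {n : ℕ} (hl : Label.d2dFading i n ∈ S) :
    Measurable[⨆ l ∈ S, E.sigma l] (E.h i n) :=
  measurable_of_mem hl (comap_measurable _)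

lemma measurable_timeOn {i : Fin M} {n : ℕ} (hl : Label.d2dTime i n ∈ S) :
    Measurable[⨆ l ∈ S, E.sigma l] (E.timeOn i n) :=
  measurable_of_mem hl (comap_measurable _)

lemma measurable_freqOn {i : Fin M} {n : ℕ} (hl : Label.d2dFreq i n ∈ S) :
    Measurable[⨆ l ∈ S, E.sigma l] (E.freqOn i n) :=
  measurable_of_mem hl (comap_measurable _)

lemma measurable_onD {i : Fin M} {n : ℕ} (hl : Label.d2dTime i n ∈ S)
    (hl' : Label.d2dFreq i n ∈ S) : Measurable[⨆ l ∈ S, E.sigma l] (E.onD i n) := by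
  have h : Measurable fun z : Bool × Bool => z.1 && z.2 := measurable_of_countable _
  exact h.comp ((measurable_timeOn hl).prodMk (measurable_freqOn hl'))

lemma measurable_Y (hl : Label.bsLoc ∈ S) :
    Measurable[⨆ l ∈ S, E.sigma l] fun ω n => E.Y n ω :=
  measurable_of_mem hl (comap_measurable _)

lemma measurable_g {n : ℕ} (hl : Label.bsFading n ∈ S) :
    Measurable[⨆ l ∈ S, E.sigma l] (E.g n) :=
  measurable_of_mem hl (comap_measurable _)

lemma measurable_busy {n : ℕ} (hl : Label.bsBusy n ∈ S) :
    Measurable[⨆ l ∈ S, E.sigma l] (E.busy n) :=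
  measurable_of_mem hl (comap_measurable _)

end Measurability

end Elements

/-- The names of the random elements that determine the D2D interference of type `i`. -/
def Label.ofType {M : ℕ} (i : Fin M) : Set (Label M) :=
  {l | l = .d2dLoc i ∨ ∃ n, l = .d2dFading i n ∨ l = .d2dTime i n ∨ l = .d2dFreq i n}

/-- The names of the random elements that determine the interference of the base stations. -/
def Label.ofBS (M : ℕ) : Set (Label M) :=
  {l | l = .bsLoc ∨ ∃ n, l = .bsFading n ∨ l = .bsBusy n}

namespace Elements

variable {M : ℕ} {Ω : Type*} {E : Elements M Ω} {S : Set (Label M)} (p : Params M)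

lemma measurable_interfDType {i : Fin M} (hS : Label.ofType i ⊆ S) :
    Measurable[⨆ l ∈ S, E.sigma l] (E.interfDType p i) :=
  measurable_interf_comp (m := ⨆ l ∈ S, E.sigma l)
    (fun n => (measurable_pi_apply n).comp (measurable_X (hS (Or.inl rfl))))
    (fun n => measurable_onD (hS (Or.inr ⟨n, by simp⟩)) (hS (Or.inr ⟨n, by simp⟩)))
    (fun n => measurable_h (hS (Or.inr ⟨n, by simp⟩))) _ _

lemma measurable_interfD (hS : ∀ i, Label.ofType i ⊆ S) :
    Measurable[⨆ l ∈ S, E.sigma l] (E.interfD p) := by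
  have : E.interfD p = fun ω => ∑ i, E.interfDType p i ω := funext (E.interfD_eq p)
  rw [this]
  exact @Finset.measurable_fun_sum _ _ _ _ _ _ (⨆ l ∈ S, E.sigma l) _ _
    fun i _ => measurable_interfDType p (hS i)

lemma measurable_interfB (hS : Label.ofBS M ⊆ S) :
    Measurable[⨆ l ∈ S, E.sigma l] (E.interfB p) :=
  measurable_interf_comp (m := ⨆ l ∈ S, E.sigma l)
    (fun n => (measurable_pi_apply n).comp (measurable_Y (hS (Or.inl rfl))))
    (fun n => measurable_busy (hS (Or.inr ⟨n, by simp⟩)))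
    (fun n => measurable_g (hS (Or.inr ⟨n, by simp⟩))) _ _

end Elements

/-! ### Independence in the network and the D2D interference. -/

namespace IsSharedNetwork

variable {M : ℕ} {p : Params M} {Ω : Type*} [mΩ : MeasurableSpace Ω] {P : Measure Ω}
  {E : Elements M Ω}

lemma sigma_le (hE : IsSharedNetwork p P E) (l : Label M) : E.sigma l ≤ mΩ := by
  cases l with
  | linkLoc => exact hE.X0_measurable.comap_le
  | linkFading => exact hE.h0_measurable.comap_le
  | d2dLoc i => exact (measurable_pi_iff.2 (hE.X_poisson i).measurable).comap_le
  | d2dFading i n => exact (hE.h_measurable i n).comap_le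
  | d2dTime i n => exact (hE.timeOn_measurable i n).comap_le
  | d2dFreq i n => exact (hE.freqOn_measurable i n).comap_le
  | bsLoc => exact (measurable_pi_iff.2 hE.Y_poisson.measurable).comap_le
  | bsFading n => exact (hE.g_measurable n).comap_le
  | bsBusy n => exact (hE.busy_measurable n).comap_le

lemma measurable_of_labels (hE : IsSharedNetwork p P E) {β : Type*} [MeasurableSpace β] {f : Ω → β}
    {S : Set (Label M)} (hf : Measurable[⨆ l ∈ S, E.sigma l] f) : Measurable f :=
  hf.mono (iSup₂_le fun l _ => hE.sigma_le l) le_rfl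

lemma indepFun (hE : IsSharedNetwork p P E) {β γ : Type*} [MeasurableSpace β] [MeasurableSpace γ]
    {f : Ω → β} {g : Ω → γ} {S T : Set (Label M)} (hST : Disjoint S T)
    (hf : Measurable[⨆ l ∈ S, E.sigma l] f) (hg : Measurable[⨆ l ∈ T, E.sigma l] g) :
    IndepFun f g P :=
  indepFun_of_disjoint hE.sigma_le hE.independent hST hf hg

variable [IsProbabilityMeasure P]

/-- The two hopping decisions merge into one flag of probability `pt * pf`, so each D2D type is a
marked process like the base stations. -/
lemma isMarked_D (hE : IsSharedNetwork p P E) (i : Fin M) :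
    IsMarked P (E.onD i) (E.h i) (p.pt i * p.pf i) where
  on_measurable n := hE.measurable_of_labels
    (Elements.measurable_onD (S := univ) (mem_univ _) (mem_univ _))
  on_law n := by
    have h := (hE.indepFun (S := {.d2dTime i n}) (T := {.d2dFreq i n}) (by simp)
      (Elements.measurable_timeOn rfl) (Elements.measurable_freqOn rfl)).measure_inter_preimage_eq_mul
        {true} {true} (measurableSet_singleton _) (measurableSet_singleton _)
    have h1 : {ω | E.onD i n ω = true} = E.timeOn i n ⁻¹' {true} ∩ E.freqOn i n ⁻¹' {true} := by
      ext ω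
      simp [Elements.onD]
    rw [h1, h, ENNReal.ofReal_mul (p.pt_mem i).1, ← hE.timeOn_law i n, ← hE.freqOn_law i n]
    rfl
  h_measurable := hE.h_measurable i
  h_law := hE.h_law i
  indep_pair n := hE.indepFun (S := {.d2dTime i n, .d2dFreq i n}) (T := {.d2dFading i n}) (by simp)
    (Elements.measurable_onD (by simp) (by simp)) (Elements.measurable_h rfl)
  indep := iIndepFun_of_pairwise_disjoint hE.sigma_le hE.independent
    (S := fun n => {.d2dTime i n, .d2dFreq i n, .d2dFading i n})
    (fun n m hnm => by simp [Function.onFun, hnm.symm])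
    (fun n => (Elements.measurable_onD (by simp) (by simp)).prodMk
      (Elements.measurable_h (by simp)))

lemma isMarked_B (hE : IsSharedNetwork p P E) : IsMarked P E.busy E.g p.rho where
  on_measurable := hE.busy_measurable
  on_law := hE.busy_law
  h_measurable := hE.g_measurable
  h_law := hE.g_law
  indep_pair n := hE.indepFun (S := {.bsBusy n}) (T := {.bsFading n}) (by simp)
    (Elements.measurable_busy rfl) (Elements.measurable_g rfl)
  indep := iIndepFun_of_pairwise_disjoint hE.sigma_le hE.independent
    (S := fun n => {.bsBusy n, .bsFading n})
    (fun n m hnm => by simp [Function.onFun, hnm.symm])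
    (fun n => (Elements.measurable_busy (by simp)).prodMk (Elements.measurable_g (by simp)))

lemma disjoint_ofType {i j : Fin M} (hij : i ≠ j) :
    Disjoint (Label.ofType i) (Label.ofType j) := by
  rw [Set.disjoint_left]
  rintro l (rfl | ⟨n, rfl | rfl | rfl⟩) h <;> simp [Label.ofType, hij] at h

lemma disjoint_ofType_ofBS : Disjoint (⋃ i, Label.ofType i) (Label.ofBS M) := by
  rw [Set.disjoint_left]
  intro l hl h
  obtain ⟨i, hi⟩ := mem_iUnion.1 hl
  rcases hi with rfl | ⟨n, rfl | rfl | rfl⟩ <;> simp [Label.ofBS] at h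

lemma ofBS_subset {l : Label M} (hl : l = .linkLoc ∨ l = .linkFading) : Label.ofBS M ⊆ {l}ᶜ := by
  rintro l' (rfl | ⟨n, rfl | rfl⟩) <;> rcases hl with rfl | rfl <;> simp

lemma ofType_subset {i : Fin M} {l : Label M} (hl : ∀ i, l ∉ Label.ofType i) :
    Label.ofType i ⊆ {l}ᶜ := fun _ h h' => hl i (h' ▸ h)

/-- The squared-distance coefficient contributed by the D2D interference when the useful power
is `Q`. -/
lemma lintegral_interfD (hE : IsSharedNetwork p P E) {β Q r : ℝ} (hβ : 0 < β) (hQ : 0 < Q)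
    (hr : 0 < r) :
    ∫⁻ ω, expNeg (threshold p.α β Q r * E.interfD p ω) ∂P =
      expNeg (ENNReal.ofReal (2 * Real.pi * p.lamTilde *
        (∫ x in Ioi (0 : ℝ), lossKernel p.α (β * (p.PD / Q)) x) * r ^ 2)) := by
  set I := ∫ x in Ioi (0 : ℝ), lossKernel p.α (β * (p.PD / Q)) x with hI
  have hI0 : 0 ≤ I := setIntegral_nonneg measurableSet_Ioi fun x hx =>
    lossKernel_nonneg (mul_pos hβ (div_pos p.PD_pos hQ)) (le_of_lt hx)
  have hq : ∀ i, p.pt i * p.pf i ∈ Icc (0 : ℝ) 1 := fun i =>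
    ⟨mul_nonneg (p.pt_mem i).1 (p.pf_mem i).1,
      mul_le_one₀ (p.pt_mem i).2 (p.pf_mem i).1 (p.pf_mem i).2⟩
  have h1 : ∀ i, ∫⁻ ω, expNeg (threshold p.α β Q r * E.interfDType p i ω) ∂P =
      expNeg (ENNReal.ofReal (2 * Real.pi * (p.pt i * p.pf i * p.lamD i) * I * r ^ 2)) := by
    intro i
    have hind : IndepFun (fun ω n => E.X i n ω) (fun ω n => (E.onD i n ω, E.h i n ω)) P :=
      hE.indepFun (S := {.d2dLoc i}) (T := {.d2dLoc i}ᶜ) disjoint_compl_right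
        (Elements.measurable_X rfl) (measurable_marks
          (fun n => Elements.measurable_onD (by simp) (by simp))
          fun n => Elements.measurable_h (by simp))
    refine ((hE.isMarked_D i).lintegral_interf (hE.X_poisson i) (p.lamD_pos i).le hind p.α p.PD
      _).trans ?_
    rw [lossIntegral_congr_indicator_zero _ r, lossIntegral_markLaplace p.two_lt_α hβ hQ p.PD_pos
      (hq i) hr le_rfl, ← ENNReal.ofReal_mul (p.lamD_pos i).le]
    congr 2
    ring
  have hm : ∀ i, Measurable (E.interfDType p i) := fun i =>
    hE.measurable_of_labels (Elements.measurable_interfDType p (subset_univ _))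
  have hind : iIndepFun (fun i => E.interfDType p i) P :=
    iIndepFun_of_pairwise_disjoint hE.sigma_le hE.independent (S := Label.ofType)
      (fun i j hij => disjoint_ofType hij)
      fun i => Elements.measurable_interfDType p subset_rfl
  simp_rw [E.interfD_eq, Finset.mul_sum]
  rw [lintegral_expNeg_sum (fun i => (hm i).const_mul _)
    (hind.comp (fun _ z => threshold p.α β Q r * z) fun _ => measurable_id.const_mul _)]
  simp_rw [h1]
  -- The types are independent, so exponents add and the thinned densities sum to `lamTilde`.
  rw [← expNeg_sum, ← ENNReal.ofReal_sum_of_nonneg]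
  · congr 2
    rw [Params.lamTilde, Finset.mul_sum, Finset.sum_mul, Finset.sum_mul]
  · intro i _
    have := (hq i).1
    have := (p.lamD_pos i).le
    positivity

end IsSharedNetwork

/-! ### Vanishing noise, and coverage of the D2D links. -/

/-- Letting the noise power tend to zero in a coverage probability. -/
lemma tendsto_coverage {Ω : Type*} [MeasurableSpace Ω] {P : Measure Ω} [IsProbabilityMeasure P]
    {α β Q A L : ℝ} (hα : 0 ≤ α) {R : Ω → ℝ} (hR : Measurable R) {C : ℝ → ℝ}
    (hC : ∀ σ2, C σ2 = (∫⁻ ω, expNeg (threshold α β Q (R ω) * ENNReal.ofReal σ2 +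
      ENNReal.ofReal (A * R ω ^ 2)) ∂P).toReal)
    (hL : 0 ≤ L) (h0 : ∫⁻ ω, expNeg (ENNReal.ofReal (A * R ω ^ 2)) ∂P = ENNReal.ofReal L) :
    C 0 = L ∧ Tendsto C (𝓝[>] 0) (𝓝 L) := by
  have h1 : C 0 = L := by
    rw [hC]
    simp only [ENNReal.ofReal_zero, mul_zero, zero_add]
    rw [h0, ENNReal.toReal_ofReal hL]
  refine ⟨h1, ?_⟩
  rw [← h1, hC 0, funext hC]
  refine (ENNReal.tendsto_toReal
    ((lintegral_expNeg_le_one _).trans_lt ENNReal.one_lt_top).ne).comp ?_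
  refine tendsto_lintegral_expNeg (fun σ2 => ?_) (Eventually.of_forall fun ω => ?_)
  · exact ((continuous_threshold.measurable.comp hR).mul_const _).add
      ((hR.pow_const 2).const_mul A).ennreal_ofReal
  · refine Tendsto.add (ENNReal.Tendsto.const_mul ?_ (Or.inr (threshold_ne_top hα)))
      tendsto_const_nhds
    exact ENNReal.tendsto_ofReal (tendsto_id.mono_left nhdsWithin_le_nhds)

namespace IsSharedNetwork

variable {M : ℕ} {p : Params M} {Ω : Type*} [MeasurableSpace Ω] {P : Measure Ω}
  {E : Elements M Ω}

lemma lintegral_normSq_X0 (hE : IsSharedNetwork p P E) {c : ℝ} (hc : 0 ≤ c) :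
    ∫⁻ ω, expNeg (ENNReal.ofReal (c * ‖E.X0 ω‖ ^ 2)) ∂P =
      ENNReal.ofReal (1 / (2 * p.del ^ 2 * c + 1)) := by
  have hm : Measurable fun x : Plane => expNeg (ENNReal.ofReal (c * ‖x‖ ^ 2)) :=
    measurable_expNeg.comp (by fun_prop)
  rw [← lintegral_map hm hE.X0_measurable, hE.X0_law, lintegral_map hm (by fun_prop)]
  have h1 := lintegral_expNeg_normSq_stdGaussian (c := p.del ^ 2 * c) (by positivity)
  rw [show 2 * p.del ^ 2 * c + 1 = 1 + 2 * (p.del ^ 2 * c) by ring, ← h1]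
  refine lintegral_congr fun x => ?_
  rw [norm_smul, mul_pow, Real.norm_eq_abs, sq_abs]
  ring_nf

/-- The indicator of `X0 = 0` is at most `e^{-c|X0|²}` for every `c`, and the mean of the latter
tends to zero as `c` grows. -/
lemma ae_X0_ne_zero [IsProbabilityMeasure P] (hE : IsSharedNetwork p P E) : ∀ᵐ ω ∂P, E.X0 ω ≠ 0 := by
  have hδ := p.del_pos
  have hm : MeasurableSet {ω | E.X0 ω = 0} := hE.X0_measurable (measurableSet_singleton 0)
  have h1 : ∀ c : ℕ, P {ω | E.X0 ω = 0} ≤ ENNReal.ofReal (1 / (2 * p.del ^ 2 * c + 1)) := by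
    intro c
    rw [← hE.lintegral_normSq_X0 (Nat.cast_nonneg c), ← lintegral_indicator_one hm]
    refine lintegral_mono fun ω => ?_
    by_cases h : E.X0 ω = 0 <;> simp [h]
  have h2 : Tendsto (fun c : ℕ => ENNReal.ofReal (1 / (2 * p.del ^ 2 * c + 1))) atTop (𝓝 0) := by
    have : Tendsto (fun c : ℕ => 1 / (2 * p.del ^ 2 * c + 1)) atTop (𝓝 0) :=
      tendsto_const_nhds.div_atTop (tendsto_atTop_add_const_right _ _
        (tendsto_natCast_atTop_atTop.const_mul_atTop (by positivity)))
    simpa using ENNReal.tendsto_ofReal this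
  have h3 : P {ω | E.X0 ω = 0} = 0 := le_antisymm (ge_of_tendsto' h2 h1) zero_le
  rw [ae_iff]
  simpa using h3

lemma lintegral_interfB [IsProbabilityMeasure P] (hE : IsSharedNetwork p P E) {β Q r : ℝ} (hβ : 0 < β) (hQ : 0 < Q)
    (hr : 0 < r) :
    ∫⁻ ω, expNeg (threshold p.α β Q r * E.interfB p ω) ∂P =
      expNeg (ENNReal.ofReal (2 * Real.pi * (p.rho * p.lamB) *
        (∫ x in Ioi (0 : ℝ), lossKernel p.α (β * (p.PB / Q)) x) * r ^ 2)) := by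
  have hind : IndepFun (fun ω n => E.Y n ω) (fun ω n => (E.busy n ω, E.g n ω)) P :=
    hE.indepFun (S := {.bsLoc}) (T := {.bsLoc}ᶜ) disjoint_compl_right
      (Elements.measurable_Y rfl) (measurable_marks
        (fun n => Elements.measurable_busy (by simp)) fun n => Elements.measurable_g (by simp))
  refine (hE.isMarked_B.lintegral_interf hE.Y_poisson p.lamB_pos.le hind p.α p.PB _).trans ?_
  rw [lossIntegral_congr_indicator_zero _ r, lossIntegral_markLaplace p.two_lt_α hβ hQ p.PB_pos
    p.rho_mem hr le_rfl, ← ENNReal.ofReal_mul p.lamB_pos.le]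
  congr 2
  ring

lemma lossKernel_integral_nonneg {α K a : ℝ} (hK : 0 < K) (ha : 0 ≤ a) :
    0 ≤ ∫ x in Ioi a, lossKernel α K x :=
  setIntegral_nonneg measurableSet_Ioi fun _ hx => lossKernel_nonneg hK (ha.trans (le_of_lt hx))

lemma measurable_interfD (hE : IsSharedNetwork p P E) : Measurable (E.interfD p) :=
  hE.measurable_of_labels (Elements.measurable_interfD p fun _ => subset_univ _)

lemma measurable_interfB (hE : IsSharedNetwork p P E) : Measurable (E.interfB p) :=
  hE.measurable_of_labels (Elements.measurable_interfB p (subset_univ _))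

lemma lamTilde_nonneg (p : Params M) : 0 ≤ p.lamTilde :=
  Finset.sum_nonneg fun i _ =>
    mul_nonneg (mul_nonneg (p.pt_mem i).1 (p.pf_mem i).1) (p.lamD_pos i).le

/-- The coefficient of the squared link length in the coverage exponent of the D2D links. -/
noncomputable def coeffD (p : Params M) (β : ℝ) : ℝ :=
  2 * Real.pi * p.lamTilde * (∫ x in Ioi (0 : ℝ), lossKernel p.α β x) +
    2 * Real.pi * (p.rho * p.lamB) * ∫ x in Ioi (0 : ℝ), lossKernel p.α (β * (p.PB / p.PD)) x

lemma lintegral_interfDB [IsProbabilityMeasure P] (hE : IsSharedNetwork p P E) {β r : ℝ} (hβ : 0 < β) (hr : 0 < r)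
    (c : ℝ≥0∞) :
    ∫⁻ ω, expNeg (threshold p.α β p.PD r * (E.interfD p ω + E.interfB p ω + c)) ∂P =
      expNeg (threshold p.α β p.PD r * c + ENNReal.ofReal (coeffD p β * r ^ 2)) := by
  have hD := hE.lintegral_interfD hβ p.PD_pos hr
  have hB := hE.lintegral_interfB hβ p.PD_pos hr
  rw [div_self p.PD_pos.ne', mul_one] at hD
  generalize threshold p.α β p.PD r = s at *
  have hind : IndepFun (fun ω => s * E.interfD p ω) (fun ω => s * E.interfB p ω) P :=
    (hE.indepFun disjoint_ofType_ofBS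
      (Elements.measurable_interfD p fun i => subset_iUnion Label.ofType i)
      (Elements.measurable_interfB p subset_rfl)).comp
      (measurable_id.const_mul s) (measurable_id.const_mul s)
  simp_rw [mul_add, expNeg_add _ (s * c)]
  have h0 := lamTilde_nonneg p
  have h1 := p.rho_mem.1
  have h2 := p.lamB_pos.le
  have h3 := lossKernel_integral_nonneg (α := p.α) hβ le_rfl
  have h4 := lossKernel_integral_nonneg (α := p.α) (mul_pos hβ (div_pos p.PB_pos p.PD_pos)) le_rfl
  rw [lintegral_mul_const' _ _ (expNeg_ne_top _),
    lintegral_expNeg_add (hE.measurable_interfD.const_mul s) (hE.measurable_interfB.const_mul s)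
      hind, hD, hB, ← expNeg_add, ← expNeg_add,
    ← ENNReal.ofReal_add (by positivity) (by positivity), ← add_mul, add_comm, coeffD]

/-- The threshold is measurable without the label `linkFading`, hence independent of `h0`. The SINR
criterion needs `X0 ≠ 0` and `h0 > 0`, which hold almost surely. -/
lemma measure_sinrD [IsProbabilityMeasure P] (hE : IsSharedNetwork p P E) {β : ℝ} (hβ : 0 < β) (σ2 : ℝ) :
    P {ω | ENNReal.ofReal β < E.sinrD p σ2 ω} = ∫⁻ ω, expNeg (threshold p.α β p.PD ‖E.X0 ω‖ *
      (E.interfD p ω + E.interfB p ω + ENNReal.ofReal σ2)) ∂P := by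
  have hα : 0 ≤ p.α := by linarith [p.two_lt_α]
  have hthr : Measurable fun x : Plane => threshold p.α β p.PD ‖x‖ :=
    continuous_threshold.measurable.comp measurable_norm
  have hT : Measurable[⨆ l ∈ ({.linkFading}ᶜ : Set (Label M)), E.sigma l] fun ω =>
      threshold p.α β p.PD ‖E.X0 ω‖ * (E.interfD p ω + E.interfB p ω + ENNReal.ofReal σ2) :=
    (hthr.comp (Elements.measurable_X0 (by simp))).mul (((Elements.measurable_interfD p fun i =>
      ofType_subset fun i => by simp [Label.ofType]).add
        (Elements.measurable_interfB p (ofBS_subset (Or.inr rfl)))).add_const _)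
  have hh : Measurable[⨆ l ∈ ({.linkFading} : Set (Label M)), E.sigma l] E.h0 :=
    Elements.measurable_h0 (mem_singleton _)
  have hind := hE.indepFun disjoint_compl_left hT hh
  rw [← measure_lt_ofReal_of_exp hE.h0_measurable hE.h0_law (hE.measurable_of_labels hT) hind]
  refine measure_congr (eventuallyEq_set.2 ?_)
  filter_upwards [hE.ae_X0_ne_zero, ae_pos_of_exp hE.h0_measurable hE.h0_law] with ω hX hh
  exact lt_sinr_iff hα hβ p.PD_pos hh hX _

lemma coverD_eq [IsProbabilityMeasure P] (hE : IsSharedNetwork p P E) {β : ℝ} (hβ : 0 < β) (σ2 : ℝ) :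
    E.coverD p P σ2 β = (∫⁻ ω, expNeg (threshold p.α β p.PD ‖E.X0 ω‖ * ENNReal.ofReal σ2 +
      ENNReal.ofReal (coeffD p β * ‖E.X0 ω‖ ^ 2)) ∂P).toReal := by
  have hthr : Measurable fun x : Plane => threshold p.α β p.PD ‖x‖ :=
    continuous_threshold.measurable.comp measurable_norm
  have hJ : Measurable[⨆ l ∈ ({.linkLoc}ᶜ : Set (Label M)), E.sigma l] fun ω =>
      E.interfD p ω + E.interfB p ω + ENNReal.ofReal σ2 :=
    ((Elements.measurable_interfD p fun i => ofType_subset fun i => by simp [Label.ofType]).add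
      (Elements.measurable_interfB p (ofBS_subset (Or.inl rfl)))).add_const _
  have hF : Measurable (Function.uncurry fun (x : Plane) (j : ℝ≥0∞) =>
      expNeg (threshold p.α β p.PD ‖x‖ * j)) :=
    measurable_expNeg.comp ((hthr.comp measurable_fst).mul measurable_snd)
  have hX0 : Measurable[⨆ l ∈ ({.linkLoc} : Set (Label M)), E.sigma l] E.X0 :=
    Elements.measurable_X0 (mem_singleton _)
  have hind := hE.indepFun disjoint_compl_right hX0 hJ
  rw [Elements.coverD, measureReal_def, hE.measure_sinrD hβ,
    lintegral_of_indepFun hE.X0_measurable (hE.measurable_of_labels hJ) hind hF]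
  congr 1
  refine lintegral_congr_ae ?_
  filter_upwards [hE.ae_X0_ne_zero] with ω hX
  exact hE.lintegral_interfDB hβ (norm_pos_iff.2 hX) _

end IsSharedNetwork

/-! ### Coverage of the cellular users. -/

/-- The index of the point of `y` nearest to the origin. -/
noncomputable def nearestIndex (y : ℕ → Plane) : ℕ := sInf {n | ∀ m, ‖y n‖ ≤ ‖y m‖}

lemma measurable_nearestIndex : Measurable nearestIndex := by
  have hS : ∀ n, MeasurableSet {y : ℕ → Plane | ∀ m, ‖y n‖ ≤ ‖y m‖} := by
    intro n
    rw [ofPred_forall]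
    exact MeasurableSet.iInter fun m =>
      measurableSet_le (measurable_pi_apply n).norm (measurable_pi_apply m).norm
  refine measurable_to_countable' fun k => ?_
  -- The second piece is the default `sInf ∅ = 0`, taken when no point attains the minimum.
  have hset : nearestIndex ⁻¹' {k} =
      ({y | ∀ m, ‖y k‖ ≤ ‖y m‖} ∩ ⋂ j : ℕ, ⋂ _ : j < k, {y | ∀ m, ‖y j‖ ≤ ‖y m‖}ᶜ) ∪
        ({_y | k = 0} ∩ ⋂ j : ℕ, {y | ∀ m, ‖y j‖ ≤ ‖y m‖}ᶜ) := by
    ext y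
    simp only [mem_preimage, mem_singleton_iff, mem_union, mem_inter_iff, mem_iInter,
      mem_compl_iff]
    constructor
    · rintro rfl
      by_cases h : {n | ∀ m, ‖y n‖ ≤ ‖y m‖}.Nonempty
      · exact Or.inl ⟨Nat.sInf_mem h, fun j hj hj' => Nat.notMem_of_lt_sInf hj hj'⟩
      · rw [not_nonempty_iff_eq_empty] at h
        refine Or.inr ⟨?_, fun j hj => eq_empty_iff_forall_notMem.1 h j hj⟩
        change sInf _ = 0
        rw [h, Nat.sInf_empty]
    · rintro (⟨h1, h2⟩ | ⟨h1, h2⟩)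
      · refine le_antisymm (Nat.sInf_le h1) ?_
        by_contra hlt
        exact h2 _ (not_le.1 hlt) (Nat.sInf_mem (s := {n | ∀ m, ‖y n‖ ≤ ‖y m‖}) ⟨k, h1⟩)
      · have h1' : k = 0 := h1
        have h : {n | ∀ m, ‖y n‖ ≤ ‖y m‖} = ∅ := eq_empty_iff_forall_notMem.2 h2
        rw [nearestIndex, h, Nat.sInf_empty, h1']
  rw [hset]
  exact ((hS k).inter (MeasurableSet.iInter fun j => MeasurableSet.iInter fun _ => (hS j).compl)).union
    ((MeasurableSet.const _).inter (MeasurableSet.iInter fun j => (hS j).compl))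

/-- The interference at a user served by the `k`-th of the transmitters at `y`. -/
noncomputable def interfExcept (α Q : ℝ) (k : ℕ) (y : ℕ → Plane) (m : ℕ → Bool × ℝ) : ℝ≥0∞ :=
  ∑' n, if (m n).1 = true ∧ n ≠ k then rxPower α Q (m n).2 (y n) else 0

/-- The gain with index `k` is exempt from the measurability hypothesis, so this interference can be
shown independent of the serving gain. -/
lemma measurable_interfExcept {Ω : Type*} {m : MeasurableSpace Ω} {k : ℕ} {y : ℕ → Ω → Plane}
    {on : ℕ → Ω → Bool} {h : ℕ → Ω → ℝ} (hy : ∀ n, Measurable[m] (y n))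
    (hon : ∀ n, Measurable[m] (on n)) (hh : ∀ n ≠ k, Measurable[m] (h n)) (α Q : ℝ) :
    Measurable[m] fun ω => interfExcept α Q k (fun n => y n ω) (fun n => (on n ω, h n ω)) := by
  refine Measurable.tsum fun n => ?_
  by_cases hn : n = k
  · simp only [hn, ne_eq, not_true_eq_false, and_false, if_false]
    exact measurable_const
  · simp only [ne_eq, hn, not_false_eq_true, and_true]
    exact Measurable.ite (hon n (measurableSet_singleton true))
      ((measurable_rxPower α Q).comp ((hh n hn).prodMk (hy n))) measurable_const

/-- The SINR of a user served by the `k`-th of the transmitters at `y`, with additional interference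
and noise `c`. -/
noncomputable def sinrFrom (α Q : ℝ) (k : ℕ) (y : ℕ → Plane) (m : ℕ → Bool × ℝ) (c : ℝ≥0∞) :
    ℝ≥0∞ :=
  rxPower α Q (m k).2 (y k) / (c + interfExcept α Q k y m)

lemma measurable_sinrFrom (α Q : ℝ) (k : ℕ) :
    Measurable fun z : (ℕ → Plane) × (ℕ → Bool × ℝ) × ℝ≥0∞ => sinrFrom α Q k z.1 z.2.1 z.2.2 := by
  have hy : ∀ n, Measurable fun z : (ℕ → Plane) × (ℕ → Bool × ℝ) × ℝ≥0∞ => z.1 n := fun n =>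
    (measurable_pi_apply n).comp measurable_fst
  have hm : ∀ n, Measurable fun z : (ℕ → Plane) × (ℕ → Bool × ℝ) × ℝ≥0∞ => z.2.1 n := fun n =>
    (measurable_pi_apply n).comp (measurable_fst.comp measurable_snd)
  have h1 := measurable_interfExcept (k := k) hy (fun n => (hm n).fst) (fun n _ => (hm n).snd) α Q
  have h2 := (measurable_rxPower α Q).comp ((hm k).snd.prodMk (hy k))
  exact h2.div (Measurable.add (measurable_snd.comp measurable_snd) h1)

lemma measurable_apply_nat {γ : Type*} [MeasurableSpace γ] {G : ℕ → γ → ℝ≥0∞} {N : γ → ℕ}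
    (hG : ∀ k, Measurable (G k)) (hN : Measurable N) : Measurable fun z => G (N z) z := by
  have hu : Measurable (Function.uncurry G) := measurable_from_prod_countable_right hG
  exact hu.comp (hN.prodMk measurable_id)

lemma measurable_sinrFrom_nearest (α Q : ℝ) :
    Measurable fun z : (ℕ → Plane) × (ℕ → Bool × ℝ) × ℝ≥0∞ =>
      sinrFrom α Q (nearestIndex z.1) z.1 z.2.1 z.2.2 := by
  have hN : Measurable fun z : (ℕ → Plane) × (ℕ → Bool × ℝ) × ℝ≥0∞ => nearestIndex z.1 :=
    measurable_nearestIndex.comp measurable_fst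
  exact measurable_apply_nat (measurable_sinrFrom α Q) hN

/-- With `monotone_negLog_markLaplace`, this verifies the hypotheses of `lintegral_nearest`. At `y =
0` the factor `‖y‖ₑ ^ (-α)` is infinite, hence the exclusion. -/
lemma continuous_negLog_markLaplace {α β Q Q' q : ℝ} {y : Plane} (hy : y ≠ 0) :
    Continuous fun r => negLog (markLaplace α Q' q (threshold α β Q r) y) := by
  refine continuous_negLog.comp ?_
  have h1 : Continuous fun r => threshold α β Q r * (ENNReal.ofReal Q' * ‖y‖ₑ ^ (-α)) := by
    refine (ENNReal.continuous_mul_const ?_).comp continuous_threshold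
    rw [enorm_rpow_neg hy]
    exact ENNReal.mul_ne_top ENNReal.ofReal_ne_top ENNReal.ofReal_ne_top
  exact (ENNReal.continuous_sub_left ENNReal.one_ne_top).comp
    ((ENNReal.continuous_const_mul ENNReal.ofReal_ne_top).comp
      ((ENNReal.continuous_sub_left ENNReal.one_ne_top).comp
        (continuous_inv.comp (continuous_const.add h1))))

lemma monotone_negLog_markLaplace {α β Q Q' q : ℝ} (hα : 0 ≤ α) (y : Plane) :
    Monotone fun r => negLog (markLaplace α Q' q (threshold α β Q r) y) := by
  intro r r' h
  refine negLog_antitone ?_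
  unfold markLaplace
  have := monotone_threshold (β := β) (Q := Q) hα h
  gcongr

namespace IsSharedNetwork

lemma measurable_interfExcept_labels {M : ℕ} {p : Params M} {Ω : Type*}
    {E : Elements M Ω} (y : ℕ → Plane) (k : ℕ) {S : Set (Label M)}
    (hb : ∀ n, .bsBusy n ∈ S) (hg : ∀ n ≠ k, .bsFading n ∈ S) :
    Measurable[⨆ l ∈ S, E.sigma l] fun ω =>
      interfExcept p.α p.PB k y (fun n => (E.busy n ω, E.g n ω)) :=
  measurable_interfExcept (m := ⨆ l ∈ S, E.sigma l) (y := fun n _ => y n)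
    (fun _ => measurable_const) (fun n => Elements.measurable_busy (hb n))
    (fun n hn => Elements.measurable_g (hg n hn)) _ _

variable {M : ℕ} {p : Params M} {Ω : Type*} [MeasurableSpace Ω] {P : Measure Ω}
  {E : Elements M Ω}

/-- The coefficient of the squared link length in the contribution of the D2D interference to the
coverage exponent of the cellular users. -/
noncomputable def coeffC (p : Params M) (β : ℝ) : ℝ :=
  2 * Real.pi * p.lamTilde * ∫ x in Ioi (0 : ℝ), lossKernel p.α (β * (p.PD / p.PB)) x

variable [IsProbabilityMeasure P]

/-- The coverage probability of a cellular user, given the locations of the base stations. -/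
lemma measure_sinrFrom (hE : IsSharedNetwork p P E) {β : ℝ} (hβ : 0 < β) (c : ℝ≥0∞)
    {y : ℕ → Plane} {k : ℕ} (hy : y k ≠ 0) :
    P {ω | ENNReal.ofReal β < sinrFrom p.α p.PB k y (fun n => (E.busy n ω, E.g n ω))
        (E.interfD p ω + c)} =
      expNeg (threshold p.α β p.PB ‖y k‖ * c + ENNReal.ofReal (coeffC p β * ‖y k‖ ^ 2) +
        ∑' n, if n ≠ k then
          negLog (markLaplace p.α p.PB p.rho (threshold p.α β p.PB ‖y k‖) (y n)) else 0) := by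
  have hα : 0 ≤ p.α := by linarith [p.two_lt_α]
  set s := threshold p.α β p.PB ‖y k‖ with hs
  set I : Ω → ℝ≥0∞ := fun ω => interfExcept p.α p.PB k y (fun n => (E.busy n ω, E.g n ω)) with hI
  have hIm : Measurable[⨆ l ∈ ({.bsFading k}ᶜ : Set (Label M)), E.sigma l] I :=
    measurable_interfExcept_labels y k (by simp) (by simp)
  have hT : Measurable[⨆ l ∈ ({.bsFading k}ᶜ : Set (Label M)), E.sigma l] fun ω =>
      s * (E.interfD p ω + c + I ω) :=
    (((Elements.measurable_interfD p fun i => ofType_subset fun i => by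
      simp [Label.ofType]).add_const _).add hIm).const_mul s
  have hg : Measurable[⨆ l ∈ ({.bsFading k} : Set (Label M)), E.sigma l] (E.g k) :=
    Elements.measurable_g (mem_singleton _)
  have h1 := measure_lt_ofReal_of_exp (hE.g_measurable k) (hE.g_law k) (hE.measurable_of_labels hT)
    (hE.indepFun disjoint_compl_left hT hg)
  have h2 : P {ω | ENNReal.ofReal β < sinrFrom p.α p.PB k y (fun n => (E.busy n ω, E.g n ω))
      (E.interfD p ω + c)} = P {ω | s * (E.interfD p ω + c + I ω) < ENNReal.ofReal (E.g k ω)} := by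
    refine measure_congr (eventuallyEq_set.2 ?_)
    filter_upwards [ae_pos_of_exp (hE.g_measurable k) (hE.g_law k)] with ω hω
    exact lt_sinr_iff hα hβ p.PB_pos hω hy _
  have hIB : Measurable[⨆ l ∈ Label.ofBS M, E.sigma l] I :=
    measurable_interfExcept_labels y k (fun n => Or.inr ⟨n, by simp⟩)
      fun n _ => Or.inr ⟨n, by simp⟩
  have hind : IndepFun (fun ω => s * E.interfD p ω) (fun ω => s * I ω) P :=
    (hE.indepFun disjoint_ofType_ofBS
      (Elements.measurable_interfD p fun i => subset_iUnion Label.ofType i) hIB).comp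
      (measurable_id.const_mul s) (measurable_id.const_mul s)
  have h3 : ∀ ω, expNeg (s * (E.interfD p ω + c + I ω)) =
      expNeg (s * c) * expNeg (s * E.interfD p ω + s * I ω) := by
    intro ω
    rw [← expNeg_add]
    congr 1
    ring
  have h4 : ∫⁻ ω, expNeg (s * I ω) ∂P = expNeg (∑' n, if n ≠ k then
      negLog (markLaplace p.α p.PB p.rho s (y n)) else 0) :=
    hE.isMarked_B.lintegral_fixed p.α p.PB s {n | n ≠ k} y
  rw [h2, h1]
  simp_rw [h3]
  rw [lintegral_const_mul' _ _ (expNeg_ne_top _),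
    lintegral_expNeg_add (hE.measurable_interfD.const_mul s)
      ((hE.measurable_of_labels hIB).const_mul s) hind,
    hE.lintegral_interfD hβ p.PB_pos (norm_pos_iff.2 hy), h4, ← expNeg_add, ← expNeg_add, coeffC,
    add_assoc]

/-- The serving index is a function of the base station locations alone, so freezing these locations
makes it a constant `k` while the marks and the D2D field keep their law. -/
lemma measure_sinrC (hE : IsSharedNetwork p P E) (β σ2 : ℝ) :
    P {ω | ENNReal.ofReal β < E.sinrC p σ2 ω} =
      ∫⁻ ω, P {ω' | ENNReal.ofReal β < sinrFrom p.α p.PB (E.serving ω) (fun n => E.Y n ω)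
        (fun n => (E.busy n ω', E.g n ω')) (E.interfD p ω' + ENNReal.ofReal σ2)} ∂P := by
  set V : Ω → (ℕ → Bool × ℝ) × ℝ≥0∞ := fun ω =>
    (fun n => (E.busy n ω, E.g n ω), E.interfD p ω + ENNReal.ofReal σ2) with hV
  have hVS : Measurable[⨆ l ∈ ({.bsLoc}ᶜ : Set (Label M)), E.sigma l] V :=
    (measurable_marks (fun n => Elements.measurable_busy (by simp))
      fun n => Elements.measurable_g (by simp)).prodMk
      ((Elements.measurable_interfD p fun i => ofType_subset fun i => by
        simp [Label.ofType]).add_const _)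
  have hYS : Measurable[⨆ l ∈ ({.bsLoc} : Set (Label M)), E.sigma l] fun ω n => E.Y n ω :=
    Elements.measurable_Y (mem_singleton _)
  have hind := hE.indepFun disjoint_compl_right hYS hVS
  have hA : MeasurableSet {z : (ℕ → Plane) × (ℕ → Bool × ℝ) × ℝ≥0∞ |
      ENNReal.ofReal β < sinrFrom p.α p.PB (nearestIndex z.1) z.1 z.2.1 z.2.2} :=
    measurableSet_lt measurable_const (measurable_sinrFrom_nearest _ _)
  set A := {z : (ℕ → Plane) × (ℕ → Bool × ℝ) × ℝ≥0∞ |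
      ENNReal.ofReal β < sinrFrom p.α p.PB (nearestIndex z.1) z.1 z.2.1 z.2.2} with hAdef
  have hF : Measurable (Function.uncurry fun (y : ℕ → Plane) (v : (ℕ → Bool × ℝ) × ℝ≥0∞) =>
      A.indicator (1 : (ℕ → Plane) × (ℕ → Bool × ℝ) × ℝ≥0∞ → ℝ≥0∞) (y, v)) := measurable_one.indicator hA
  have hYm := hE.measurable_of_labels hYS
  have hVm := hE.measurable_of_labels hVS
  have h1 := lintegral_of_indepFun hYm hVm hind hF
  have h2 : {ω | ENNReal.ofReal β < E.sinrC p σ2 ω} = (fun ω => ((fun n => E.Y n ω), V ω)) ⁻¹' A := by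
    ext ω
    rw [mem_ofPred_eq, mem_preimage, hAdef, mem_ofPred_eq, Elements.sinrC, sinrFrom, add_right_comm]
    rfl
  rw [h2, ← lintegral_indicator_one ((hYm.prodMk hVm) hA)]
  refine h1.trans (lintegral_congr fun ω => ?_)
  exact lintegral_indicator_one ((measurable_prodMk_left.comp hVm) hA)

lemma coverC_eq (hE : IsSharedNetwork p P E) {β : ℝ} (hβ : 0 < β) (σ2 : ℝ) :
    E.coverC p P σ2 β = (∫⁻ ω, expNeg (threshold p.α β p.PB (nearDist E.Y ω) * ENNReal.ofReal σ2 +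
      ENNReal.ofReal ((coeffC p β + 2 * Real.pi * (p.rho * p.lamB) *
        ∫ x in Ioi (1 : ℝ), lossKernel p.α β x) * nearDist E.Y ω ^ 2)) ∂P).toReal := by
  have hα : 0 ≤ p.α := by linarith [p.two_lt_α]
  set g : ℝ → ℝ≥0∞ := fun r => threshold p.α β p.PB r * ENNReal.ofReal σ2 +
    ENNReal.ofReal (coeffC p β * r ^ 2) with hg
  set F : ℝ → Plane → ℝ≥0∞ := fun r y =>
    negLog (markLaplace p.α p.PB p.rho (threshold p.α β p.PB r) y) with hF
  have hgc : Continuous g :=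
    ((ENNReal.continuous_mul_const ENNReal.ofReal_ne_top).comp continuous_threshold).add
      (ENNReal.continuous_ofReal.comp (by fun_prop))
  have hnear : ∀ᵐ ω ∂P, ‖E.Y (E.serving ω) ω‖ = nearDist E.Y ω := by
    filter_upwards [hE.Y_poisson.ae_exists_nearest] with ω hω
    have hmem : E.serving ω ∈ {n | ∀ m, ‖E.Y n ω‖ ≤ ‖E.Y m ω‖} := Nat.sInf_mem hω
    exact le_antisymm (le_ciInf hmem) (nearDist_le _ _ _)
  have h1 : P {ω | ENNReal.ofReal β < E.sinrC p σ2 ω} = ∫⁻ ω, expNeg (g (nearDist E.Y ω) +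
      ∑' n, {x : Plane | nearDist E.Y ω < ‖x‖}.indicator (F (nearDist E.Y ω)) (E.Y n ω)) ∂P := by
    rw [hE.measure_sinrC]
    refine lintegral_congr_ae ?_
    -- Distances being almost surely distinct, the stations other than the serving one are exactly
    -- those strictly beyond `nearDist`; this replaces the condition on indices by an indicator in
    -- space.
    filter_upwards [hnear, hE.Y_poisson.ae_ne_zero, hE.Y_poisson.ae_norm_injective p.lamB_pos.le]
      with ω h h0 hinj
    refine (hE.measure_sinrFrom hβ _ (h0 _)).trans ?_
    rw [h]
    congr 2
    refine tsum_congr fun n => ?_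
    by_cases hn : n = E.serving ω
    · rw [if_neg (not_not.2 hn), indicator_of_notMem]
      simp [hn, h]
    · rw [if_pos hn, indicator_of_mem]
      exact lt_of_le_of_ne (nearDist_le _ _ _) fun he => hn (hinj (he.symm.trans h.symm))
  rw [Elements.coverC, measureReal_def, h1, hE.Y_poisson.lintegral_nearest (F := F) p.lamB_pos.le hgc
    (fun r => measurable_negLog.comp (measurable_markLaplace _ _ _ _))
    (fun y => monotone_negLog_markLaplace hα y) fun y hy => continuous_negLog_markLaplace hy]
  congr 1
  refine lintegral_congr_ae ?_
  filter_upwards [hnear, hE.Y_poisson.ae_ne_zero] with ω h h0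
  have hr : 0 < nearDist E.Y ω := h ▸ norm_pos_iff.2 (h0 _)
  have hloss := lossIntegral_markLaplace (a := 1) p.two_lt_α hβ p.PB_pos p.PB_pos p.rho_mem hr
    zero_le_one
  rw [one_mul, div_self p.PB_pos.ne', mul_one] at hloss
  have hc : 0 ≤ coeffC p β := by
    have h1 := lamTilde_nonneg p
    have h2 := lossKernel_integral_nonneg (α := p.α) (mul_pos hβ (div_pos p.PD_pos p.PB_pos)) le_rfl
    unfold coeffC
    positivity
  have h5 := p.rho_mem.1
  have h6 := p.lamB_pos.le
  have h7 := lossKernel_integral_nonneg (α := p.α) hβ zero_le_one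
  simp only [hF, hg]
  rw [hloss, ← ENNReal.ofReal_mul h6, add_assoc, ← ENNReal.ofReal_add (by positivity) (by positivity)]
  congr 3
  ring

end IsSharedNetwork

end D2D

/-! ### Identification of the constants. -/

theorem mainTheorem4 {M : ℕ} (p : D2D.Params M) {Ω : Type*} [MeasurableSpace Ω]
    (P : Measure Ω) [IsProbabilityMeasure P] (E : D2D.Elements M Ω)
    (hE : D2D.IsSharedNetwork p P E) (β : ℝ) (hβ : 0 < β) :
    IntegrableOn (p.H0fun β) (Ioi 0) ∧ IntegrableOn (p.H1fun β) (Ioi 1) ∧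
    (E.coverD p P 0 β =
      1 / (2 * p.del ^ 2 * p.lamTilde * p.kappa * Real.pi * β ^ (2 / p.α)
        + 4 * p.del ^ 2 * Real.pi * p.rho * p.lamB * p.H0 β + 1)) ∧
    Tendsto (fun σ2 : ℝ => E.coverD p P σ2 β) (𝓝[>] 0)
      (𝓝 (1 / (2 * p.del ^ 2 * p.lamTilde * p.kappa * Real.pi * β ^ (2 / p.α)
        + 4 * p.del ^ 2 * Real.pi * p.rho * p.lamB * p.H0 β + 1))) ∧
    (E.coverC p P 0 β =
      1 / (p.lamTilde / p.lamB * p.kappa * (β * (p.PD / p.PB)) ^ (2 / p.α)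
        + 2 * p.rho * p.H1 β + 1)) ∧
    Tendsto (fun σ2 : ℝ => E.coverC p P σ2 β) (𝓝[>] 0)
      (𝓝 (1 / (p.lamTilde / p.lamB * p.kappa * (β * (p.PD / p.PB)) ^ (2 / p.α)
        + 2 * p.rho * p.H1 β + 1))) := by
  open D2D IsSharedNetwork in
  have hα : 0 ≤ p.α := by linarith [p.two_lt_α]
  have hPD := p.PD_pos
  have hPB := p.PB_pos
  have hlB := p.lamB_pos
  have hρ := p.rho_mem.1
  have hlt := lamTilde_nonneg p
  -- `K` is β times the ratio of interfering to useful power: `P_B/P_D` for base stations heard on a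
  -- D2D link. For base stations heard by a cellular user the ratio is one, so the `H₁` kernel has
  -- `K = β`.
  have hH0 : p.H0fun β = lossKernel p.α (β * (p.PB / p.PD)) := by
    funext x
    rw [D2D.Params.H0fun, lossKernel, mul_inv, inv_div]
  have hH1 : p.H1fun β = lossKernel p.α β := rfl
  have hK0 : 0 < β * (p.PB / p.PD) := by positivity
  have hK1 : 0 < β * (p.PD / p.PB) := by positivity
  have i0 := lossKernel_integral_nonneg (α := p.α) hβ le_rfl
  have i1 := lossKernel_integral_nonneg (α := p.α) hK0 le_rfl
  have i2 := lossKernel_integral_nonneg (α := p.α) hK1 le_rfl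
  have i3 := lossKernel_integral_nonneg (α := p.α) hβ zero_le_one
  have hcD : 0 ≤ coeffD p β := by
    unfold coeffD
    positivity
  have hcC : 0 ≤ coeffC p β + 2 * Real.pi * (p.rho * p.lamB) *
      ∫ x in Ioi (1 : ℝ), lossKernel p.α β x := by
    unfold coeffC
    positivity
  have hD := tendsto_coverage (C := fun σ2 => E.coverD p P σ2 β) hα hE.X0_measurable.norm
    (fun σ2 => hE.coverD_eq hβ σ2) (by positivity) (hE.lintegral_normSq_X0 hcD)
  have hC := tendsto_coverage (C := fun σ2 => E.coverC p P σ2 β) hα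
    (measurable_nearDist hE.Y_poisson.measurable) (fun σ2 => hE.coverC_eq hβ σ2) (by positivity)
    (hE.Y_poisson.lintegral_nearDist_sq hlB hcC)
  -- D2D transmitters share the useful power, so `K = β` and their radial integral is `κ β^{2/α} /
  -- 2`.
  have eD : 2 * p.del ^ 2 * p.lamTilde * p.kappa * Real.pi * β ^ (2 / p.α)
        + 4 * p.del ^ 2 * Real.pi * p.rho * p.lamB * p.H0 β + 1 =
      2 * p.del ^ 2 * coeffD p β + 1 := by
    rw [coeffD, (integral_lossKernel p.two_lt_α hβ).2, D2D.Params.H0, hH0, D2D.Params.kappa]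
    ring
  have eC : p.lamTilde / p.lamB * p.kappa * (β * (p.PD / p.PB)) ^ (2 / p.α)
        + 2 * p.rho * p.H1 β + 1 =
      (coeffC p β + 2 * Real.pi * (p.rho * p.lamB) * ∫ x in Ioi (1 : ℝ), lossKernel p.α β x) /
        (Real.pi * p.lamB) + 1 := by
    rw [coeffC, (integral_lossKernel p.two_lt_α hK1).2, D2D.Params.H1, hH1, D2D.Params.kappa]
    have := Real.pi_pos
    field_simp
  rw [eD, eC]
  refine ⟨?_, ?_, hD.1, hD.2, hC.1, hC.2⟩
  · rw [hH0]
    exact (integral_lossKernel p.two_lt_α hK0).1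
  · rw [hH1]
    exact (integral_lossKernel p.two_lt_α hβ).1.mono_set (Ioi_subset_Ioi zero_le_one)
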